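/- Let $k\ge 1$ and let $C_1,\dots,C_k:[0,1]\to\mathbb{R}^3$ be continuous curves, with indices read cyclically ($C_{k+1}=C_1$). Assume $\|C_i(1)-C_{i+1}(0)\|\le\tfrac12$ for every $i$. Let $C$ be the closed curve obtained by running through $C_1,\dots,C_k$ in this order and joining, for each $i$, the end point $C_i(1)$ to the initial point $C_{i+1}(0)$ by a straight line segment. Let $m$ be a point of the convex hull of (the image of) $C$, and let $K$ be the $m$-cone of $C$, that is, $K=\{y\,c+(1-y)\,m : c\in C,\ y\in[0,1]\}$. Let $A\subseteq K$ be a non-empty set such that $\mathrm{dist}(x,C_i)\ge 1$ for all $x\in A$ and all $i=1,\dots,k$, and such that $$\sup_{x\in A}\|x-m\|<\tfrac12,\qquad \mathrm{diam}(A)<\tfrac12 .$$ Put $\varphi(t)=\arcsin(2t)-t$ for $0\le t\le\tfrac12$. Then $$\sum_{i=1}^k \mathrm{len}(C_i)\ \ge\ 2\pi+2\,\mathrm{diam}(A)-\sum_{i=1}^k\varphi\bigl(\|C_i(1)-C_{i+1}(0)\|\bigr),$$ where $\mathrm{len}$ denotes the length of a curve (the supremum of the lengths of inscribed polygons, possibly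 $+\infty$). -/

import Mathlib

open scoped unitInterval

noncomputable section

/-- Euclidean three-space. -/
abbrev E3 : Type := EuclideanSpace ℝ (Fin 3)

/-- The length of a curve `[0,1] → ℝ³`: the supremum of the lengths of inscribed polygons
(its value is `∞` if the curve is not rectifiable). -/
def curveLength (c : C(I, E3)) : ENNReal := eVariationOn c Set.univ

/-- A curve `c : [0,1] → ℝ³`, regarded as a path from `c 0` to `c 1`. -/
def curvePath (c : C(I, E3)) : Path (c 0) (c 1) where
  toContinuousMap := c
  source' := rfl
  target' := rfl

/-- The concatenation `C 0 ⌢ s₀₁ ⌢ C 1 ⌢ s₁₂ ⌢ ⋯ ⌢ C (n-1) ⌢ sₙ₋₁,ₙ` of the first `n` curves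
(indices are read modulo `k`), where `sᵢⱼ` is the straight segment from the end point of `C i`
to the initial point of `C j`. -/
def partialInterpolation {k : ℕ} [NeZero k] (C : Fin k → C(I, E3)) :
    (n : ℕ) → Path (C 0 0) (C (Fin.ofNat k n) 0)
  | 0 => (Path.refl (C 0 0)).cast rfl (by simp)
  | n + 1 =>
    ((partialInterpolation C n).trans (curvePath (C (Fin.ofNat k n)))).trans
      (Path.segment (C (Fin.ofNat k n) 1) (C (Fin.ofNat k (n + 1)) 0))

/-- The closed curve obtained from `C 0, …, C (k-1)` by joining the end point of each curve to the
initial point of the cyclically next one by a straight segment. -/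
def interpolatedClosedCurve {k : ℕ} [NeZero k] (C : Fin k → C(I, E3)) : Path (C 0 0) (C 0 0) :=
  (partialInterpolation C k).cast rfl (by
    have h : Fin.ofNat k k = 0 := by ext; simp
    rw [h])

/-- The `p`-cone `(x, y) ↦ y • c(x) + (1 - y) • p` of a closed curve `c` (a loop
parametrized by `[0,1]`). It is constant on `y = 0` and takes equal values at `(0, y)` and `(1, y)`,
so it is a map from a disk; only its image will matter. -/
def cone {a : E3} (c : Path a a) (p : E3) : I × I → E3 :=
  fun z => (z.2 : ℝ) • c z.1 + (1 - (z.2 : ℝ)) • p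

/-- The function `φ(t) = arcsin(2t) - t`. -/
def phi (t : ℝ) : ℝ := Real.arcsin (2 * t) - t

end

/-! Each `C i` is replaced by a fine inscribed polygon, and each joining segment, of length d, by a
two-edge tent: its tip is the midpoint pushed away from m by d²/2. The tent keeps distance at least
1 from A, the cone over it covers the cone over the segment, and its length is at most d + d³/2 ≤
φ(d). So the theorem reduces to `le_length_of_closed_polygon`, for a closed polygon with m in its
convex hull and two points a, b of its m-cone at distance at least ρ from it. This is applied with ρ
= 1 - ε, and ε tends to 0.

For the polygon, the cone is developed: a point is recorded by its distance from the apex and the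
swept angle T. As the apex lies in the convex hull, the total angle Θ is at least 2π (`two_pi_le`).
A 1-Lipschitz map f of the angle compresses Θ to 2π and yields a closed plane curve no longer than
the polygon. It is chosen so that the parts of the cone seen from a and b in the relevant directions
stay isometric. In direction θ from a, and in the opposite direction from b, the curve is met at
distance at least ρ. Its width in direction θ is therefore at least 2ρ plus the component of a - b,
taken in the plane. Integration over the half-circle of directions around that of a - b gives length
at least 2πρ + 2D (`le_length_of_width`), where D, the planar distance of the two points, is at
least |a - b|.

The choice of f depends on whether the cone geodesic from a to b passes through the apex
(`le_length_of_pi_le`, `le_length_of_le_pi`). -/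

noncomputable section

open Set Real Filter Topology

/-! ### Widths and lengths of closed plane curves -/

/-- The component of a complex number in the direction `e^{iθ}`. -/
def dirComp (θ : ℝ) (w : ℂ) : ℝ := w.re * cos θ + w.im * sin θ

theorem dirComp_sub (θ : ℝ) (w w' : ℂ) : dirComp θ (w - w') = dirComp θ w - dirComp θ w' := by
  simp [dirComp]; ring

theorem dirComp_eq (θ : ℝ) (w : ℂ) : dirComp θ w = ‖w‖ * cos (θ - w.arg) := by
  rw [dirComp, cos_sub]
  have h1 := Complex.norm_mul_cos_arg w
  have h2 := Complex.norm_mul_sin_arg w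
  rw [mul_add, mul_left_comm, h1, mul_left_comm, h2]; ring

theorem abs_dirComp_le (θ : ℝ) (w : ℂ) : |dirComp θ w| ≤ ‖w‖ := by
  rw [dirComp_eq, abs_mul, abs_norm]
  exact mul_le_of_le_one_right (norm_nonneg _) (abs_cos_le_one _)

theorem continuous_dirComp (w : ℂ) : Continuous fun θ => dirComp θ w := by
  unfold dirComp; fun_prop

theorem integral_abs_cos_half_period (c : ℝ) :
    ∫ x in (c - π / 2)..(c + π / 2), |cos x| = 2 := by
  have hp : Function.Periodic (fun x => |cos x|) π := fun x => by simp [cos_add_pi]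
  have h := hp.intervalIntegral_add_eq (c - π / 2) (-(π / 2))
  have e1 : c - π / 2 + π = c + π / 2 := by ring
  have e2 : -(π / 2) + π = π / 2 := by ring
  rw [e1, e2] at h
  rw [h]
  have : ∫ x in (-(π / 2))..(π / 2), |cos x| = ∫ x in (-(π / 2))..(π / 2), cos x := by
    refine intervalIntegral.integral_congr fun x hx => ?_
    rw [uIcc_of_le (by linarith [pi_pos])] at hx
    exact abs_of_nonneg (cos_nonneg_of_mem_Icc hx)
  rw [this, integral_cos]; simp; norm_num

theorem integral_abs_dirComp (δ : ℝ) (w : ℂ) :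
    ∫ θ in (δ - π / 2)..(δ + π / 2), |dirComp θ w| = 2 * ‖w‖ := by
  simp_rw [dirComp_eq, abs_mul, abs_norm]
  rw [intervalIntegral.integral_const_mul,
    intervalIntegral.integral_comp_sub_right (fun x => |cos x|)]
  have := integral_abs_cos_half_period (δ - w.arg)
  rw [show δ - π / 2 - w.arg = δ - w.arg - π / 2 by ring,
    show δ + π / 2 - w.arg = δ - w.arg + π / 2 by ring, this]; ring

/-- A closed sequence travels from one value to the other and back, and each leg costs at least
their difference. -/
theorem two_mul_sub_le_sum_abs_of_closed (x : ℕ → ℝ) {M i j : ℕ} (hi : i ≤ M) (hj : j ≤ M)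
    (hx : x 0 = x M) : 2 * (x i - x j) ≤ ∑ k ∈ Finset.range M, |x (k + 1) - x k| := by
  have key : ∀ {i j : ℕ}, i ≤ j → j ≤ M →
      2 * |x i - x j| ≤ ∑ k ∈ Finset.range M, |x (k + 1) - x k| := by
    intro i j hij hj
    have h1 := dist_le_range_sum_dist x i
    have h2 := dist_le_Ico_sum_dist x hij
    have h3 := dist_le_Ico_sum_dist x hj
    have e : ∀ k, dist (x k) (x (k + 1)) = |x (k + 1) - x k| := fun k => by
      rw [dist_comm, Real.dist_eq]
    simp only [e] at h1 h2 h3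
    have s1 := Finset.sum_range_add_sum_Ico (fun k => |x (k + 1) - x k|) (hij.trans hj)
    have s2 := Finset.sum_Ico_consecutive (fun k => |x (k + 1) - x k|) hij hj
    rw [Real.dist_eq] at h1 h2 h3
    have : |x i - x j| ≤ |x 0 - x i| + |x j - x M| := by
      rw [← hx, abs_sub_comm (x 0), abs_sub_comm (x j)]
      have := abs_sub_le (x i) (x 0) (x j)
      linarith
    linarith
  rcases le_total i j with h | h
  · linarith [key h hj, le_abs_self (x i - x j)]
  · linarith [key h hi, neg_abs_le (x j - x i)]

/-- A Cauchy–Crofton estimate: a lower bound for the widths of a closed plane curve in a half-period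
of directions gives a lower bound for its length. -/
theorem le_length_of_width {z : ℝ → ℂ} {l : ℝ → ℝ} {s₀ s₁ Λ ρ D δ : ℝ} (h01 : s₀ ≤ s₁)
    (hz : ∀ s s', s₀ ≤ s → s ≤ s' → s' ≤ s₁ → ‖z s' - z s‖ ≤ l s' - l s)
    (hl : ∀ s s', s₀ ≤ s → s ≤ s' → s' ≤ s₁ → l s' - l s ≤ Λ * (s' - s))
    (hclosed : z s₀ = z s₁)
    (hw : ∀ θ ∈ Icc (δ - π / 2) (δ + π / 2), ∃ s ∈ Icc s₀ s₁, ∃ s' ∈ Icc s₀ s₁,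
      2 * ρ + D * cos (θ - δ) ≤ dirComp θ (z s) - dirComp θ (z s')) :
    2 * π * ρ + 2 * D ≤ l s₁ - l s₀ := by
  -- Replacing the two extremal points by grid points costs at most |Λ| times the mesh each; this
  -- error vanishes as M grows.
  have main : ∀ M : ℕ, 2 * π * ρ + 2 * D - 2 * π * (|Λ| * ((s₁ - s₀) / (M + 1))) ≤ l s₁ - l s₀ := by
    intro M
    set h : ℝ := (s₁ - s₀) / (M + 1) with hh
    have hM : (0 : ℝ) < M + 1 := by positivity
    have hh0 : 0 ≤ h := div_nonneg (by linarith) hM.le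
    have hMh : (M + 1) * h = s₁ - s₀ := by rw [hh]; field_simp
    set p : ℕ → ℝ := fun k => s₀ + k * h with hp
    have p0 : p 0 = s₀ := by simp [hp]
    have pM : p (M + 1) = s₁ := by simp only [hp]; push_cast; linarith
    have psucc : ∀ k, p (k + 1) = p k + h := fun k => by simp only [hp]; push_cast; ring
    have ple : ∀ k, k ≤ M + 1 → p k ≤ s₁ := fun k hk => by
      rw [← pM]; simp only [hp]; gcongr
    have pge : ∀ k, s₀ ≤ p k := fun k => by simp only [hp]; nlinarith [k.cast_nonneg (α := ℝ)]
    have near : ∀ s ∈ Icc s₀ s₁, ∃ k ≤ M + 1, ‖z s - z (p k)‖ ≤ |Λ| * h := by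
      intro s hs
      rcases hh0.eq_or_lt with h0 | h0
      · refine ⟨0, by omega, ?_⟩
        have : s₁ = s₀ := by rw [← h0] at hMh; linarith
        have : s = s₀ := le_antisymm (this ▸ hs.2) hs.1
        rw [p0, this, ← h0]; simp
      · have hq : 0 ≤ (s - s₀) / h := div_nonneg (by linarith [hs.1]) h0.le
        have f1 := Nat.floor_le hq
        have f2 := (Nat.lt_floor_add_one ((s - s₀) / h)).le
        rw [le_div_iff₀ h0] at f1
        rw [div_le_iff₀ h0] at f2
        refine ⟨⌊(s - s₀) / h⌋₊, ?_, ?_⟩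
        · refine Nat.floor_le_of_le ?_
          rw [div_le_iff₀ h0]; push_cast; linarith [hs.2]
        · set k := ⌊(s - s₀) / h⌋₊
          have a1 : p k ≤ s := by simp only [hp]; linarith
          have a2 : s - p k ≤ h := by simp only [hp]; linarith
          have b1 := hz _ _ (pge k) a1 hs.2
          have b2 := hl _ _ (pge k) a1 hs.2
          have b3 : Λ * (s - p k) ≤ |Λ| * h :=
            mul_le_mul (le_abs_self _) a2 (by linarith) (abs_nonneg _)
          linarith
    have hpt : ∀ θ ∈ Icc (δ - π / 2) (δ + π / 2), 2 * (2 * ρ + D * cos (θ - δ) - 2 * (|Λ| * h)) ≤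
        ∑ k ∈ Finset.range (M + 1), |dirComp θ (z (p (k + 1)) - z (p k))| := by
      intro θ hθ
      obtain ⟨s, hs, s', hs', hss⟩ := hw θ hθ
      obtain ⟨i, hi, hi'⟩ := near s hs
      obtain ⟨j, hj, hj'⟩ := near s' hs'
      have c := two_mul_sub_le_sum_abs_of_closed (fun k => dirComp θ (z (p k))) hi hj
        (by simp only [p0, pM, hclosed])
      have d1 := (abs_le.1 ((abs_dirComp_le θ _).trans hi')).2
      have d2 := (abs_le.1 ((abs_dirComp_le θ _).trans hj')).1
      rw [dirComp_sub] at d1 d2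
      simp only [dirComp_sub]
      linarith
    have hint := intervalIntegral.integral_mono_on (μ := MeasureTheory.volume)
      (a := δ - π / 2) (b := δ + π / 2) (by linarith [pi_pos])
      (f := fun θ => 2 * (2 * ρ + D * cos (θ - δ) - 2 * (|Λ| * h)))
      (g := fun θ => ∑ k ∈ Finset.range (M + 1), |dirComp θ (z (p (k + 1)) - z (p k))|)
      (Continuous.intervalIntegrable (by fun_prop) _ _)
      (Continuous.intervalIntegrable
        (continuous_finsetSum _ fun k _ => (continuous_dirComp _).abs) _ _) hpt
    rw [intervalIntegral.integral_finsetSum (fun k _ =>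
      ((continuous_dirComp _).abs).intervalIntegrable _ _)] at hint
    simp only [integral_abs_dirComp] at hint
    have hcos : ∫ θ in (δ - π / 2)..(δ + π / 2), cos (θ - δ) = 2 := by
      rw [intervalIntegral.integral_comp_sub_right (fun x => cos x), integral_cos]
      have e1 : δ + π / 2 - δ = π / 2 := by ring
      have e2 : δ - π / 2 - δ = -(π / 2) := by ring
      rw [e1, e2]; simp; norm_num
    have hleft : ∫ θ in (δ - π / 2)..(δ + π / 2), 2 * (2 * ρ + D * cos (θ - δ) - 2 * (|Λ| * h))
        = 2 * (2 * π * ρ + 2 * D - 2 * π * (|Λ| * h)) := by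
      rw [intervalIntegral.integral_const_mul, intervalIntegral.integral_sub
        (Continuous.intervalIntegrable (by fun_prop) _ _) (by simp),
        intervalIntegral.integral_add (by simp) (Continuous.intervalIntegrable (by fun_prop) _ _),
        intervalIntegral.integral_const_mul D, hcos]
      simp; ring
    rw [hleft, ← Finset.mul_sum] at hint
    have hsum : ∑ k ∈ Finset.range (M + 1), ‖z (p (k + 1)) - z (p k)‖ ≤ l s₁ - l s₀ := by
      calc _ ≤ ∑ k ∈ Finset.range (M + 1), (l (p (k + 1)) - l (p k)) := by
            refine Finset.sum_le_sum fun k hk => hz _ _ (pge k) (by linarith [psucc k]) (ple _ ?_)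
            have := Finset.mem_range.1 hk; omega
        _ = l s₁ - l s₀ := by rw [Finset.sum_range_sub (fun k => l (p k)), p0, pM]
    linarith
  have hlim : Tendsto (fun M : ℕ => 2 * π * ρ + 2 * D - 2 * π * (|Λ| * ((s₁ - s₀) / (M + 1))))
      atTop (𝓝 (2 * π * ρ + 2 * D - 2 * π * (|Λ| * ((s₁ - s₀) * 0)))) := by
    refine tendsto_const_nhds.sub (tendsto_const_nhds.mul (tendsto_const_nhds.mul ?_))
    simp_rw [div_eq_mul_one_div (s₁ - s₀)]
    exact tendsto_const_nhds.mul tendsto_one_div_add_atTop_nhds_zero_nat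
  simpa using le_of_tendsto' hlim main

/-- A moving point with polar coordinates `(r, τ)` which starts on the ray from the origin through
`x₀ = (ra, 0)` beyond `x₀`, and turns at least by `θ ∈ [0, π]`, staying at distance at least `ρ`
from `x₀`, crosses the ray from `x₀` in direction `θ`. -/
theorem exists_dirComp_ge {r τ : ℝ → ℝ} {s₀ s₁ ra ρ θ : ℝ} (hr : ContinuousOn r (uIcc s₀ s₁))
    (hτ : ContinuousOn τ (uIcc s₀ s₁)) (hr0 : ∀ s ∈ uIcc s₀ s₁, 0 ≤ r s)
    (hra : 0 ≤ ra) (hra' : ra ≤ r s₀) (hτ0 : τ s₀ = 0)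
    (hτm : ∀ s ∈ uIcc s₀ s₁, τ s ∈ Icc 0 π)
    (hdist : ∀ s ∈ uIcc s₀ s₁, ρ ^ 2 ≤ r s ^ 2 + ra ^ 2 - 2 * r s * ra * cos (τ s))
    (hθ : θ ∈ Icc 0 π) (hτ1 : θ ≤ τ s₁) :
    ∃ s ∈ uIcc s₀ s₁, ρ + ra * cos θ ≤ r s * cos (τ s - θ) := by
  have m0 : s₀ ∈ uIcc s₀ s₁ := left_mem_uIcc
  have m1 : s₁ ∈ uIcc s₀ s₁ := right_mem_uIcc
  -- For θ = 0 and θ = π the sine degenerates, but an endpoint of the motion already lies on the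
  -- ray.
  rcases hθ.1.eq_or_lt with rfl | hθ0
  · refine ⟨s₀, m0, ?_⟩
    have := hdist _ m0
    rw [hτ0] at this ⊢
    simp only [cos_zero, sub_zero, mul_one] at this ⊢
    have := abs_le_of_sq_le_sq' (show ρ ^ 2 ≤ (r s₀ - ra) ^ 2 by linarith) (by linarith)
    linarith
  rcases hθ.2.eq_or_lt with rfl | hθ1
  · refine ⟨s₁, m1, ?_⟩
    have e : τ s₁ = π := le_antisymm (hτm _ m1).2 hτ1
    have := hdist _ m1
    rw [e] at this ⊢
    simp only [cos_pi, sub_self, cos_zero] at this ⊢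
    have := abs_le_of_sq_le_sq' (show ρ ^ 2 ≤ (r s₁ + ra) ^ 2 by linarith)
      (by linarith [hr0 _ m1])
    linarith
  have hsin : 0 < sin θ := sin_pos_of_pos_of_lt_pi hθ0 hθ1
  -- This function vanishes exactly when the moving point is on the line through x₀ in direction θ.
  have hc : ContinuousOn (fun s => r s * sin (τ s - θ) + ra * sin θ) (uIcc s₀ s₁) :=
    (hr.mul (continuous_sin.comp_continuousOn (hτ.sub continuousOn_const))).add continuousOn_const
  have h0 : (0 : ℝ) ∈ uIcc (r s₀ * sin (τ s₀ - θ) + ra * sin θ)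
      (r s₁ * sin (τ s₁ - θ) + ra * sin θ) := by
    rw [mem_uIcc]; left
    constructor
    · rw [hτ0, zero_sub, sin_neg]; nlinarith
    · have : 0 ≤ sin (τ s₁ - θ) :=
        sin_nonneg_of_nonneg_of_le_pi (by linarith) (by linarith [(hτm _ m1).2])
      have := mul_nonneg (hr0 _ m1) this
      positivity
  obtain ⟨s, hs, hs0⟩ := intermediate_value_uIcc hc h0
  refine ⟨s, hs, ?_⟩
  have hd := hdist s hs
  -- The moving point stays in the upper half-plane, which selects the forward ray of that line.
  have hY : 0 ≤ r s * sin (τ s) :=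
    mul_nonneg (hr0 s hs) (sin_nonneg_of_nonneg_of_le_pi (hτm s hs).1 (hτm s hs).2)
  simp only [sin_sub] at hs0
  rw [cos_sub]
  set X := r s * cos (τ s) - ra with hX
  set Y := r s * sin (τ s) with hYd
  have hcross : Y * cos θ - X * sin θ = 0 := by rw [hX, hYd]; linarith
  have hsc := sin_sq_add_cos_sq θ
  have hdot : (X * cos θ + Y * sin θ) * sin θ = Y := by
    linear_combination cos θ * (-hcross) + Y * hsc
  have hpos : 0 ≤ X * cos θ + Y * sin θ := by
    by_contra! hneg
    nlinarith [mul_neg_of_neg_of_pos hneg hsin]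
  have hsq : ρ ^ 2 ≤ (X * cos θ + Y * sin θ) ^ 2 := by
    have e : (X * cos θ + Y * sin θ) ^ 2 = X ^ 2 + Y ^ 2 := by
      linear_combination (X ^ 2 + Y ^ 2) * hsc - (Y * cos θ - X * sin θ) * hcross
    have e2 : X ^ 2 + Y ^ 2 = r s ^ 2 + ra ^ 2 - 2 * r s * ra * cos (τ s) := by
      rw [hX, hYd]; linear_combination (r s ^ 2) * sin_sq_add_cos_sq (τ s)
    rw [e, e2]; exact hd
  have := abs_le_of_sq_le_sq' hsq hpos
  rw [hX, hYd] at this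
  linarith

end

/-! ### Developed cones over closed curves -/

noncomputable section

open Set Real Filter Topology

variable {V : Type*} [NormedAddCommGroup V]

/-- The plane curve with radius `‖c s‖` and polar angle `f (T s)`. -/
def polarCurve (c : ℝ → V) (T f : ℝ → ℝ) (s : ℝ) : ℂ :=
  ⟨‖c s‖ * cos (f (T s)), ‖c s‖ * sin (f (T s))⟩

theorem dirComp_polarCurve (c : ℝ → V) (T f : ℝ → ℝ) (s θ : ℝ) :
    dirComp θ (polarCurve c T f s) = ‖c s‖ * cos (f (T s) - θ) := by
  simp only [dirComp, polarCurve, cos_sub]; ring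

variable [InnerProductSpace ℝ V]

/-- `c` is a curve of period `N` avoiding the origin, `T` is the angle swept out by the cone over `c`
with apex at the origin (`Θ` in one period), and `l` is the length of `c` (`L` in one period). -/
structure IsDeveloped (c : ℝ → V) (T l : ℝ → ℝ) (N Θ L : ℝ) : Prop where
  period_nonneg : 0 ≤ N
  continuousOn : ContinuousOn c (Ici 0)
  continuousOn_angle : ContinuousOn T (Ici 0)
  ne_zero : ∀ s, 0 ≤ s → c s ≠ 0
  angle_le : ∀ s s', 0 ≤ s → s ≤ s' → InnerProductGeometry.angle (c s) (c s') ≤ T s' - T s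
  norm_polarCurve_sub_le : ∀ f : ℝ → ℝ, (∀ t t', |f t - f t'| ≤ |t - t'|) → ∀ s s', 0 ≤ s → s ≤ s' →
    ‖polarCurve c T f s' - polarCurve c T f s‖ ≤ l s' - l s
  lipschitz : ∃ Λ, ∀ s s', 0 ≤ s → s ≤ s' → l s' - l s ≤ Λ * (s' - s)
  periodic : ∀ s, 0 ≤ s → c (s + N) = c s
  angle_period : ∀ s, 0 ≤ s → T (s + N) = T s + Θ
  length_period : ∀ s, 0 ≤ s → l (s + N) = l s + L

namespace IsDeveloped

variable {c : ℝ → V} {T l : ℝ → ℝ} {N Θ L : ℝ}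

theorem monotoneOn (h : IsDeveloped c T l N Θ L) : MonotoneOn T (Ici 0) := fun s hs s' _ hss => by
  linarith [h.angle_le s s' hs hss, InnerProductGeometry.angle_nonneg (c s) (c s')]

theorem exists_angle_eq (h : IsDeveloped c T l N Θ L) {s s' t : ℝ} (hs : 0 ≤ s) (hss : s ≤ s')
    (h1 : T s ≤ t) (h2 : t ≤ T s') : ∃ u ∈ Icc s s', T u = t :=
  intermediate_value_Icc hss (h.continuousOn_angle.mono fun _ hx => hs.trans hx.1) ⟨h1, h2⟩

/-- The swept angle dominates the true angle, so by the law of cosines development does not decrease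
distances while the swept angle is at most π. The bound ρ thus passes to the plane. -/
theorem sq_le (h : IsDeveloped c T l N Θ L) {s s₀ y ρ : ℝ} (hs : 0 ≤ s) (hs₀ : 0 ≤ s₀)
    (hy : 0 ≤ y) (hρ : 0 ≤ ρ) (hd : ρ ≤ dist (c s) (y • c s₀)) (hT : |T s - T s₀| ≤ π) :
    ρ ^ 2 ≤ ‖c s‖ ^ 2 + ‖y • c s₀‖ ^ 2 - 2 * ‖c s‖ * ‖y • c s₀‖ * cos |T s - T s₀| := by
  have hang : InnerProductGeometry.angle (c s) (c s₀) ≤ |T s - T s₀| := by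
    rcases le_total s s₀ with hh | hh
    · rw [abs_sub_comm]; exact (h.angle_le _ _ hs hh).trans (le_abs_self _)
    · rw [InnerProductGeometry.angle_comm]; exact (h.angle_le _ _ hs₀ hh).trans (le_abs_self _)
  have hcos := cos_le_cos_of_nonneg_of_le_pi (InnerProductGeometry.angle_nonneg _ _) hT hang
  have hi : inner ℝ (c s) (y • c s₀)
      = ‖c s‖ * ‖y • c s₀‖ * cos (InnerProductGeometry.angle (c s) (c s₀)) := by
    rw [inner_smul_right, norm_smul, Real.norm_of_nonneg hy,
      ← InnerProductGeometry.cos_angle_mul_norm_mul_norm]; ring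
  have hsq := pow_le_pow_left₀ hρ hd 2
  rw [dist_eq_norm, norm_sub_sq_real, hi] at hsq
  nlinarith [mul_le_mul_of_nonneg_left hcos
    (mul_nonneg (norm_nonneg (c s)) (norm_nonneg (y • c s₀)))]

/-- Seen from the point `y • c s₀`, the developed curve is hit in every direction `θ ∈ [-π, π]`
for which the swept angle of the curve reaches `T s₀ + θ`. -/
theorem exists_le_mul_cos (h : IsDeveloped c T l N Θ L) {s₀ s₁ s₂ y ρ θ : ℝ} (h1 : 0 ≤ s₁)
    (h10 : s₁ ≤ s₀) (h02 : s₀ ≤ s₂) (hy : y ∈ Icc 0 1) (hρ : 0 ≤ ρ)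
    (hd : ∀ s, 0 ≤ s → ρ ≤ dist (c s) (y • c s₀)) (hθ : θ ∈ Icc (-π) π)
    (hT : T s₀ + θ ∈ Icc (T s₁) (T s₂)) :
    ∃ s ∈ Icc s₁ s₂, T s ∈ uIcc (T s₀) (T s₀ + θ) ∧
      ρ + ‖y • c s₀‖ * cos θ ≤ ‖c s‖ * cos (T s - T s₀ - θ) := by
  have h0 : 0 ≤ s₀ := h1.trans h10
  have hra : ‖y • c s₀‖ ≤ ‖c s₀‖ := by
    rw [norm_smul, Real.norm_of_nonneg hy.1]; exact mul_le_of_le_one_left (norm_nonneg _) hy.2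
  rcases le_total 0 θ with hθ0 | hθ0
  · obtain ⟨u, hu, hTu⟩ := h.exists_angle_eq h0 h02 (t := T s₀ + θ) (by linarith) hT.2
    have hsub : ∀ s ∈ uIcc s₀ u, s ∈ Ici (0 : ℝ) := fun s hs => by
      rw [uIcc_of_le hu.1] at hs; exact h0.trans hs.1
    have hTs : ∀ s ∈ uIcc s₀ u, T s ∈ Icc (T s₀) (T s₀ + θ) := fun s hs => by
      have h' := hsub s hs
      rw [uIcc_of_le hu.1] at hs
      exact ⟨h.monotoneOn h0 h' hs.1, hTu ▸ h.monotoneOn h' (h0.trans hu.1) hs.2⟩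
    obtain ⟨s, hs, hs'⟩ := exists_dirComp_ge (r := fun s => ‖c s‖) (τ := fun s => T s - T s₀)
      (s₀ := s₀) (s₁ := u) (ra := ‖y • c s₀‖) (ρ := ρ) (θ := θ)
      (h.continuousOn.norm.mono hsub) ((h.continuousOn_angle.mono hsub).sub continuousOn_const)
      (fun _ _ => norm_nonneg _) (norm_nonneg _) hra (sub_self _)
      (fun s hs => ⟨by linarith [(hTs s hs).1], by linarith [(hTs s hs).2, hθ.2]⟩)
      (fun s hs => by
        have e : |T s - T s₀| = T s - T s₀ := abs_of_nonneg (by linarith [(hTs s hs).1])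
        have := h.sq_le (hsub s hs) h0 hy.1 hρ (hd s (hsub s hs))
          (by rw [e]; linarith [(hTs s hs).2, hθ.2])
        rwa [e] at this)
      ⟨hθ0, hθ.2⟩ (by simp only [hTu]; linarith)
    refine ⟨s, ?_, ?_, hs'⟩
    · rw [uIcc_of_le hu.1] at hs; exact ⟨h10.trans hs.1, hs.2.trans hu.2⟩
    · rw [uIcc_of_le (by linarith)]; exact hTs s hs
  · obtain ⟨u, hu, hTu⟩ := h.exists_angle_eq h1 h10 (t := T s₀ + θ) hT.1 (by linarith)
    have hu0 : 0 ≤ u := h1.trans hu.1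
    have hsub : ∀ s ∈ uIcc s₀ u, s ∈ Ici (0 : ℝ) := fun s hs => by
      rw [uIcc_of_ge hu.2] at hs; exact hu0.trans hs.1
    have hTs : ∀ s ∈ uIcc s₀ u, T s ∈ Icc (T s₀ + θ) (T s₀) := fun s hs => by
      have h' := hsub s hs
      rw [uIcc_of_ge hu.2] at hs
      exact ⟨hTu ▸ h.monotoneOn hu0 h' hs.1, h.monotoneOn h' h0 hs.2⟩
    obtain ⟨s, hs, hs'⟩ := exists_dirComp_ge (r := fun s => ‖c s‖) (τ := fun s => T s₀ - T s)
      (s₀ := s₀) (s₁ := u) (ra := ‖y • c s₀‖) (ρ := ρ) (θ := -θ)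
      (h.continuousOn.norm.mono hsub) (continuousOn_const.sub (h.continuousOn_angle.mono hsub))
      (fun _ _ => norm_nonneg _) (norm_nonneg _) hra (sub_self _)
      (fun s hs => ⟨by linarith [(hTs s hs).2], by linarith [(hTs s hs).1, hθ.1]⟩)
      (fun s hs => by
        have e : |T s - T s₀| = T s₀ - T s := by
          rw [abs_sub_comm]; exact abs_of_nonneg (by linarith [(hTs s hs).2])
        have := h.sq_le (hsub s hs) h0 hy.1 hρ (hd s (hsub s hs))
          (by rw [e]; linarith [(hTs s hs).1, hθ.1])
        rwa [e] at this)
      ⟨by linarith, by linarith [hθ.1]⟩ (by simp only [hTu]; linarith)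
    refine ⟨s, ?_, ?_, ?_⟩
    · rw [uIcc_of_ge hu.2] at hs; exact ⟨hu.1.trans hs.1, hs.2.trans h02⟩
    · rw [uIcc_of_ge (by linarith)]; exact hTs s hs
    · rw [cos_neg] at hs'
      rwa [← cos_neg (T s - T s₀ - θ), show -(T s - T s₀ - θ) = T s₀ - T s - -θ by ring]

/-- Compressing the angle by a 1-Lipschitz f does not lengthen the curve, and a gain of 2π over one
period closes it, so the plane width estimate applies. -/
theorem le_length (h : IsDeveloped c T l N Θ L) {f : ℝ → ℝ} (hf : ∀ t t', |f t - f t'| ≤ |t - t'|)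
    {s₀ ρ D δ : ℝ} (hs : 0 ≤ s₀) (hcl : f (T s₀ + Θ) = f (T s₀) + 2 * π)
    (hw : ∀ θ ∈ Icc (δ - π / 2) (δ + π / 2), ∃ s ∈ Icc s₀ (s₀ + N), ∃ s' ∈ Icc s₀ (s₀ + N),
      2 * ρ + D * cos (θ - δ) ≤ ‖c s‖ * cos (f (T s) - θ) - ‖c s'‖ * cos (f (T s') - θ)) :
    2 * π * ρ + 2 * D ≤ L := by
  obtain ⟨Λ, hΛ⟩ := h.lipschitz
  have := le_length_of_width (z := polarCurve c T f) (l := l) (s₀ := s₀) (s₁ := s₀ + N) (Λ := Λ)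
    (ρ := ρ) (D := D) (δ := δ) (by linarith [h.period_nonneg])
    (fun s s' h1 h2 _ => h.norm_polarCurve_sub_le f hf s s' (hs.trans h1) h2)
    (fun s s' h1 h2 _ => hΛ s s' (hs.trans h1) h2)
    (by simp [polarCurve, h.periodic s₀ hs, h.angle_period s₀ hs, hcl])
    (by simpa only [dirComp_polarCurve] using hw)
  rw [h.length_period s₀ hs] at this
  linarith

/-- Choice of a period of the parameter interval that contains `sa` and `sb`. -/
theorem exists_window (h : IsDeveloped c T l N Θ L) {sa sb t₁ t₂ : ℝ} (hN : N ≤ sa) (hab : sa ≤ sb)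
    (hba : sb ≤ sa + N) (h1 : t₁ ≤ T sa) (h2 : T sb ≤ t₂) (h3 : t₂ ≤ T sa + Θ)
    (h4 : t₂ ≤ t₁ + Θ) :
    ∃ s₁ s₂, 0 ≤ s₁ ∧ s₁ ≤ sa ∧ sb ≤ s₂ ∧ s₂ ≤ s₁ + N ∧ T s₁ = t₁ ∧ T s₂ = t₂ := by
  have ha : 0 ≤ sa := h.period_nonneg.trans hN
  obtain ⟨s₂, hs₂, e₂⟩ := h.exists_angle_eq (ha.trans hab) hba h2 (by rwa [h.angle_period sa ha])
  have hp : 0 ≤ s₂ - N := by linarith [hs₂.1]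
  have e := h.angle_period _ hp
  rw [sub_add_cancel, e₂] at e
  obtain ⟨s₁, hs₁, e₁⟩ := h.exists_angle_eq hp (by linarith [hs₂.2]) (by linarith) h1
  exact ⟨s₁, s₂, hp.trans hs₁.1, hs₁.2, hs₂.1, by linarith [hs₁.1], e₁, e₂⟩

/-- The case that the geodesic between the two points passes through the apex. -/
theorem le_length_of_pi_le (h : IsDeveloped c T l N Θ L) {sa sb ya yb ρ : ℝ} (hN : N ≤ sa)
    (hab : sa ≤ sb) (hba : sb ≤ sa + N) (hya : ya ∈ Icc 0 1) (hyb : yb ∈ Icc 0 1) (hρ : 0 ≤ ρ)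
    (hda : ∀ s, 0 ≤ s → ρ ≤ dist (c s) (ya • c sa)) (hdb : ∀ s, 0 ≤ s → ρ ≤ dist (c s) (yb • c sb))
    (h1 : π ≤ T sb - T sa) (h2 : π ≤ Θ - (T sb - T sa)) :
    2 * π * ρ + 2 * dist (ya • c sa) (yb • c sb) ≤ L := by
  have hπ := pi_pos
  obtain ⟨s₁, s₂, hs₁, hsa, hsb, hs₂, e₁, e₂⟩ := h.exists_window (t₁ := T sa - π / 2)
    (t₂ := T sb + π / 2) hN hab hba (by linarith) (by linarith) (by linarith) (by linarith)
  have hD : dist (ya • c sa) (yb • c sb) ≤ ‖ya • c sa‖ + ‖yb • c sb‖ := by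
    rw [dist_eq_norm]; exact norm_sub_le _ _
  -- This f keeps the sectors of half-angle π/2 around a and b and collapses everything else. The
  -- two sectors become complementary half-planes, with a at angle 0 and b at angle π, whence D =
  -- ‖a‖ + ‖b‖ and δ = 0.
  refine le_trans (by linarith) (h.le_length
    (f := fun t => max (min (t - T sa) (π / 2)) (min (t - T sb + π) (3 * π / 2))) ?_ hs₁ ?_
    (ρ := ρ) (D := ‖ya • c sa‖ + ‖yb • c sb‖) (δ := 0) ?_)
  · intro t t'
    refine (abs_max_sub_max_le_max _ _ _ _).trans (max_le ?_ ?_)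
    · refine (abs_min_sub_min_le_max _ _ _ _).trans (max_le (le_of_eq ?_) (by simp))
      congr 1; ring
    · refine (abs_min_sub_min_le_max _ _ _ _).trans (max_le (le_of_eq ?_) (by simp))
      congr 1; ring
  · simp only [e₁]
    rw [min_eq_right (by linarith), min_eq_right (by linarith), min_eq_left (by linarith),
      min_eq_left (by linarith), max_eq_right (by linarith), max_eq_left (by linarith)]
    ring
  · intro θ hθ
    rw [zero_sub, zero_add] at hθ
    have hθ' : θ ∈ Icc (-π) π := ⟨by linarith [hθ.1], by linarith [hθ.2]⟩
    obtain ⟨s, hs, hTs, hs'⟩ := h.exists_le_mul_cos hs₁ hsa (hab.trans hsb) hya hρ hda hθ'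
      ⟨by linarith [hθ.1], by linarith [hθ.2]⟩
    obtain ⟨u, hu, hTu, hu'⟩ := h.exists_le_mul_cos hs₁ (hsa.trans hab) hsb hyb hρ hdb hθ'
      ⟨by linarith [hθ.1], by linarith [hθ.2]⟩
    refine ⟨s, ⟨hs.1, hs.2.trans hs₂⟩, u, ⟨hu.1, hu.2.trans hs₂⟩, ?_⟩
    have b1 : T s - T sa ∈ Icc (-(π / 2)) (π / 2) := by
      rcases mem_uIcc.1 hTs with hh | hh <;> constructor <;> linarith [hθ.1, hθ.2]
    have b2 : T u - T sb ∈ Icc (-(π / 2)) (π / 2) := by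
      rcases mem_uIcc.1 hTu with hh | hh <;> constructor <;> linarith [hθ.1, hθ.2]
    have f1 : max (min (T s - T sa) (π / 2)) (min (T s - T sb + π) (3 * π / 2)) = T s - T sa := by
      rw [min_eq_left b1.2, min_eq_left (by linarith [b1.2]), max_eq_left (by linarith)]
    have f2 : max (min (T u - T sa) (π / 2)) (min (T u - T sb + π) (3 * π / 2))
        = T u - T sb + π := by
      rw [min_eq_right (by linarith [b2.1]), min_eq_left (by linarith [b2.2]),
        max_eq_right (by linarith [b2.1])]
    simp only [f1, f2, sub_zero]
    rw [show T u - T sb + π - θ = T u - T sb - θ + π by ring, cos_add_pi]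
    linarith

/-- Polar coordinates of a - b, for a at angle 0 and b at angle β. The bounds β - π ≤ δ ≤ 0 are what
later allows a suitable cut of the cone. -/
theorem exists_polar_sub {ra rb β : ℝ} (ha : 0 ≤ ra) (hb : 0 ≤ rb) (hβ : β ∈ Icc 0 π) :
    ∃ D δ, 0 ≤ D ∧ δ ≤ 0 ∧ β - δ ≤ π ∧ ra - rb * cos β = D * cos δ ∧ -(rb * sin β) = D * sin δ := by
  set w : ℂ := ⟨ra - rb * cos β, rb * sin β⟩ with hw
  have hs := sin_nonneg_of_nonneg_of_le_pi hβ.1 hβ.2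
  have him : 0 ≤ w.im := mul_nonneg hb hs
  have hA := Complex.arg_nonneg_iff.2 him
  have h1 := Complex.norm_mul_cos_arg w
  have h2 := Complex.norm_mul_sin_arg w
  simp only [hw] at h1 h2
  rw [← hw] at h1 h2
  refine ⟨‖w‖, -w.arg, norm_nonneg _, by linarith, ?_, by rw [cos_neg]; linarith,
    by rw [sin_neg]; linarith⟩
  -- Beyond π the sine of β + arg w would be negative, although its product with ‖w‖ is ra · sin β ≥
  -- 0; the value 2π is excluded separately.
  by_contra! hlt
  have h3 : ‖w‖ * sin (β + w.arg) = ra * sin β := by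
    rw [sin_add]; linear_combination sin β * h1 + cos β * h2
  have hw0 : 0 < ‖w‖ := by
    rcases (norm_nonneg w).eq_or_lt with h0 | h0
    · rw [norm_eq_zero.1 h0.symm, Complex.arg_zero] at hlt; linarith [hβ.2]
    · exact h0
  have hle := Complex.arg_le_pi w
  rcases (show β + w.arg ≤ 2 * π by linarith [hβ.2]).eq_or_lt with he | hl
  · have e1 : w.arg = π := by linarith [hβ.2]
    have e2 : β = π := by linarith
    rw [e1, e2] at h1
    simp only [cos_pi] at h1
    linarith
  · have : sin (β + w.arg) < 0 := by
      rw [← sin_sub_two_pi]; exact sin_neg_of_neg_of_neg_pi_lt (by linarith) (by linarith)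
    nlinarith [mul_nonneg ha hs]

/-- The case that the geodesic between the two points does not pass through the apex. -/
theorem le_length_of_le_pi (h : IsDeveloped c T l N Θ L) {sa sb ya yb ρ : ℝ} (hN : N ≤ sa)
    (hab : sa ≤ sb) (hba : sb ≤ sa + N) (hya : ya ∈ Icc 0 1) (hyb : yb ∈ Icc 0 1) (hρ : 0 ≤ ρ)
    (hda : ∀ s, 0 ≤ s → ρ ≤ dist (c s) (ya • c sa)) (hdb : ∀ s, 0 ≤ s → ρ ≤ dist (c s) (yb • c sb))
    (hΘ : 2 * π ≤ Θ) (h1 : T sb - T sa ≤ π) :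
    2 * π * ρ + 2 * dist (ya • c sa) (yb • c sb) ≤ L := by
  have hπ := pi_pos
  have ha : 0 ≤ sa := h.period_nonneg.trans hN
  have hβ0 : T sa ≤ T sb := h.monotoneOn ha (ha.trans hab) hab
  obtain ⟨β, hβ⟩ : ∃ β, β = T sb - T sa := ⟨_, rfl⟩
  obtain ⟨D, δ, hD, hδ, hβδ, ec, es⟩ := exists_polar_sub (norm_nonneg (ya • c sa))
    (norm_nonneg (yb • c sb)) (β := β) ⟨by linarith, by linarith⟩
  have hdD : dist (ya • c sa) (yb • c sb) ≤ D := by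
    refine abs_le_of_sq_le_sq' ?_ hD |>.2
    have hcos := cos_le_cos_of_nonneg_of_le_pi (InnerProductGeometry.angle_nonneg _ _) h1
      (h.angle_le sa sb ha hab)
    rw [← hβ] at hcos
    have hi : inner ℝ (ya • c sa) (yb • c sb) = ‖ya • c sa‖ * ‖yb • c sb‖
        * cos (InnerProductGeometry.angle (c sa) (c sb)) := by
      rw [inner_smul_right, inner_smul_left, norm_smul, norm_smul, Real.norm_of_nonneg hya.1,
        Real.norm_of_nonneg hyb.1, ← InnerProductGeometry.cos_angle_mul_norm_mul_norm]
      simp; ring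
    have e : D ^ 2 = ‖ya • c sa‖ ^ 2 + ‖yb • c sb‖ ^ 2
        - 2 * (‖ya • c sa‖ * ‖yb • c sb‖ * cos β) := by
      linear_combination (-(D ^ 2)) * sin_sq_add_cos_sq δ
        + ‖yb • c sb‖ ^ 2 * sin_sq_add_cos_sq β
        - (D * cos δ + (‖ya • c sa‖ - ‖yb • c sb‖ * cos β)) * ec
        - (D * sin δ - ‖yb • c sb‖ * sin β) * es
    rw [dist_eq_norm, norm_sub_sq_real, hi, e]
    nlinarith [mul_le_mul_of_nonneg_left hcos
      (mul_nonneg (norm_nonneg (ya • c sa)) (norm_nonneg (yb • c sb)))]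
  -- The sector of angle 2π ending at T sa + γ is kept. Here γ is δ + 3π/2, opposite to the middle
  -- direction δ up to a quarter turn, clamped to [π, π + β] so that the sight angles from both
  -- points fit.
  obtain ⟨γ, hγ1, hγ2, hγ3, hγ4⟩ : ∃ γ, π ≤ γ ∧ γ ≤ π + β ∧ (γ ≤ δ + 3 * π / 2 ∨ γ = π) ∧
      (δ + 3 * π / 2 ≤ γ ∨ γ = π + β) := by
    rcases le_total (δ + 3 * π / 2) π with hh | hh
    · exact ⟨π, le_rfl, by linarith, .inr rfl, .inl hh⟩
    · rcases le_total (δ + 3 * π / 2) (π + β) with hh' | hh'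
      · exact ⟨_, hh, hh', .inl le_rfl, .inl le_rfl⟩
      · exact ⟨π + β, by linarith, le_rfl, .inl hh', .inr rfl⟩
  obtain ⟨s₁, s₂, hs₁, hsa, hsb, hs₂, e₁, e₂⟩ := h.exists_window (t₁ := T sa + γ - 2 * π)
    (t₂ := T sa + γ) hN hab hba (by linarith) (by linarith) (by linarith) (by linarith)
  refine le_trans (by linarith) (h.le_length (f := fun t => min (t - T sa) γ) ?_ hs₁ ?_
    (ρ := ρ) (D := D) (δ := δ) ?_)
  · intro t t'
    refine (abs_min_sub_min_le_max _ _ _ _).trans (max_le (le_of_eq ?_) (by simp))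
    congr 1; ring
  · simp only [e₁]
    rw [min_eq_right (by linarith), min_eq_left (by linarith)]
    ring
  · intro θ hθ
    -- Modulo 2π, the direction θ seen from a, and below the direction opposite to θ seen from b
    -- relative to its own ray, are brought into [-π, π] and into the kept sector.
    obtain ⟨θ₁, n, hn, m1, m2⟩ : ∃ θ₁, ∃ n : ℤ, θ₁ = θ + n * (2 * π) ∧ θ₁ ∈ Icc (-π) π ∧
        θ₁ ∈ Icc (γ - 2 * π) γ := by
      rcases le_total (-π) θ with hh | hh
      · refine ⟨θ, 0, by simp, ⟨hh, by linarith [hθ.2]⟩, ?_, by linarith [hθ.2]⟩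
        rcases hγ3 with h3 | h3 <;> linarith [hθ.1]
      · refine ⟨θ + 2 * π, 1, by simp, ⟨?_, ?_⟩, ?_, ?_⟩ <;> linarith [hθ.1]
    obtain ⟨θ₂, k, hk, m3, m4⟩ : ∃ θ₂, ∃ n : ℤ, θ₂ = θ - β + π + n * (2 * π) ∧ θ₂ ∈ Icc (-π) π ∧
        θ₂ + β ∈ Icc (γ - 2 * π) γ := by
      rcases le_total (θ - β) 0 with hh | hh
      · refine ⟨θ - β + π, 0, by simp, ⟨by linarith [hθ.1], by linarith⟩, by linarith [hθ.1], ?_⟩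
        rcases hγ4 with h4 | h4 <;> linarith [hθ.2]
      · refine ⟨θ - β - π, -1, by push_cast; ring, ⟨?_, ?_⟩, ?_, ?_⟩ <;> linarith [hθ.2]
    obtain ⟨s, hs, hTs, hs'⟩ := h.exists_le_mul_cos hs₁ hsa (hab.trans hsb) hya hρ hda m1
      ⟨by linarith [m2.1], by linarith [m2.2]⟩
    obtain ⟨u, hu, hTu, hu'⟩ := h.exists_le_mul_cos hs₁ (hsa.trans hab) hsb hyb hρ hdb m3
      ⟨by linarith [m4.1], by linarith [m4.2]⟩
    refine ⟨s, ⟨hs.1, hs.2.trans hs₂⟩, u, ⟨hu.1, hu.2.trans hs₂⟩, ?_⟩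
    have b1 : T s - T sa ≤ γ := by
      rcases mem_uIcc.1 hTs with hh | hh <;> linarith [m2.2]
    have b2 : T u - T sa ≤ γ := by
      rcases mem_uIcc.1 hTu with hh | hh <;> linarith [m4.2]
    simp only [min_eq_left b1, min_eq_left b2]
    have c1 : cos (T s - T sa - θ) = cos (T s - T sa - θ₁) := by
      rw [hn, ← cos_sub_int_mul_two_pi _ n]; congr 1; ring
    have c2 : cos θ₁ = cos θ := by rw [hn, cos_add_int_mul_two_pi]
    have c3 : cos (T u - T sa - θ) = -cos (T u - T sb - θ₂) := by
      rw [hk, ← cos_add_pi, ← cos_sub_int_mul_two_pi (T u - T sa - θ) k]; congr 1; linarith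
    have c4 : cos θ₂ = -cos (θ - β) := by rw [hk, cos_add_int_mul_two_pi, cos_add_pi]
    rw [c1, c3]
    rw [c2] at hs'
    rw [c4] at hu'
    have c5 : D * cos (θ - δ) = ‖ya • c sa‖ * cos θ - ‖yb • c sb‖ * cos (θ - β) := by
      rw [cos_sub, cos_sub]; linear_combination (-cos θ) * ec - sin θ * es
    rw [c5]; linarith

end IsDeveloped

end

/-! ### Polygons as developed curves -/

noncomputable section

open Set Real Filter Topology
open InnerProductGeometry (angle)

variable {X : Type*}

/-- The function on `[0, ∞)` which is `g j` (shifted by `j`) on `[j, j + 1)`. -/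
def glue (g : ℕ → ℝ → X) (s : ℝ) : X := g ⌊s⌋₊ (s - ⌊s⌋₊)

theorem glue_eq {g : ℕ → ℝ → X} (hg : ∀ j, g j 1 = g (j + 1) 0) {j : ℕ} {s : ℝ}
    (h1 : j ≤ s) (h2 : s ≤ j + 1) : glue g s = g j (s - j) := by
  rcases h2.eq_or_lt with rfl | h2
  · have : ⌊(j : ℝ) + 1⌋₊ = j + 1 := by exact_mod_cast Nat.floor_natCast (R := ℝ) (j + 1)
    simp [glue, this, hg]
  · have : ⌊s⌋₊ = j := (Nat.floor_eq_iff (by linarith [j.cast_nonneg (α := ℝ)])).2 ⟨h1, h2⟩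
    simp [glue, this]

theorem exists_nat_mem_Icc {s : ℝ} (hs : 0 ≤ s) : ∃ j : ℕ, (j : ℝ) ≤ s ∧ s ≤ j + 1 :=
  ⟨⌊s⌋₊, Nat.floor_le hs, (Nat.lt_floor_add_one s).le⟩

theorem continuousOn_glue [TopologicalSpace X] {g : ℕ → ℝ → X} (hg : ∀ j, g j 1 = g (j + 1) 0)
    (hc : ∀ j, ContinuousOn (g j) (Icc 0 1)) : ContinuousOn (glue g) (Ici 0) := by
  have hloc : ∀ j : ℕ, ContinuousOn (glue g) (Icc (j : ℝ) (j + 1)) := fun j => by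
    refine ContinuousOn.congr (f := fun s => g j (s - j)) ?_ fun s hs => glue_eq hg hs.1 hs.2
    refine (hc j).comp (by fun_prop) fun s hs => ?_
    constructor <;> linarith [hs.1, hs.2]
  have hn : ∀ n : ℕ, ContinuousOn (glue g) (Icc 0 (n : ℝ)) := by
    intro n
    induction n with
    | zero => simp
    | succ n ih =>
      have := ih.union_of_isClosed (hloc n) isClosed_Icc isClosed_Icc
      rw [Icc_union_Icc_eq_Icc (by positivity) (by linarith)] at this
      exact_mod_cast this
  intro s hs
  obtain ⟨n, h⟩ := exists_nat_gt s
  exact ((hn n) s ⟨hs, h.le⟩).mono_of_mem_nhdsWithin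
    (mem_of_superset (inter_mem_nhdsWithin _ (Iio_mem_nhds h)) fun x hx => ⟨hx.1, hx.2.le⟩)

/-- The triangle inequality chains the estimates on the single edges. -/
theorem le_sub_of_local {d : ℝ → ℝ → ℝ} {H : ℝ → ℝ} (htri : ∀ s s' s'', d s s'' ≤ d s s' + d s' s'')
    (hloc : ∀ (j : ℕ) (s s' : ℝ), j ≤ s → s ≤ s' → s' ≤ j + 1 → d s s' ≤ H s' - H s)
    {s s' : ℝ} (hs : 0 ≤ s) (hss : s ≤ s') : d s s' ≤ H s' - H s := by
  have key : ∀ n : ℕ, ∀ s', s ≤ s' → s' ≤ n + 1 → d s s' ≤ H s' - H s := by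
    intro n
    induction n with
    | zero => exact fun s' h1 h2 => hloc 0 s s' (by simpa using hs) h1 h2
    | succ n ih =>
      intro s' h1 h2
      push_cast at h2
      rcases le_total s' (n + 1) with h3 | h3
      · exact ih s' h1 h3
      rcases le_total ((n : ℝ) + 1) s with h4 | h4
      · exact hloc (n + 1) s s' (by exact_mod_cast h4) h1 (by exact_mod_cast h2)
      · have e1 := ih _ h4 le_rfl
        have e2 := hloc (n + 1) (n + 1) s' (by push_cast; rfl) h3 (by exact_mod_cast h2)
        linarith [htri s (n + 1) s']
  obtain ⟨n, -, h⟩ := exists_nat_mem_Icc (hs.trans hss)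
  exact key n s' hss h

theorem sum_range_add_period {g : ℕ → ℝ} {N : ℕ} (hg : ∀ n, g (n + N) = g n) (n : ℕ) :
    ∑ i ∈ Finset.range (n + N), g i = ∑ i ∈ Finset.range n, g i + ∑ i ∈ Finset.range N, g i := by
  induction n with
  | zero => simp
  | succ n ih => rw [Nat.succ_add, Finset.sum_range_succ, ih, Finset.sum_range_succ, hg]; ring

variable {V : Type*} [NormedAddCommGroup V]

/-- The length of a polygon. -/
def polygonLength (v : ℕ → V) : ℝ → ℝ := glue fun j x =>
  ∑ i ∈ Finset.range j, dist (v i) (v (i + 1)) + x * dist (v j) (v (j + 1))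

theorem polygonLength_eq (v : ℕ → V) {j : ℕ} {s : ℝ} (h1 : j ≤ s) (h2 : s ≤ j + 1) :
    polygonLength v s = ∑ i ∈ Finset.range j, dist (v i) (v (i + 1))
      + (s - j) * dist (v j) (v (j + 1)) :=
  glue_eq (g := fun j x => ∑ i ∈ Finset.range j, dist (v i) (v (i + 1))
    + x * dist (v j) (v (j + 1)))
    (fun j => by simp [Finset.sum_range_succ]) h1 h2

variable [InnerProductSpace ℝ V]

/-- The polygon with vertices `v 0, v 1, …`, parametrized by `[0, ∞)`. -/
def polygonCurve (v : ℕ → V) : ℝ → V := glue fun j x => AffineMap.lineMap (v j) (v (j + 1)) x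

/-- The angle swept out by a polygon, as seen from the origin. -/
def polygonAngle (v : ℕ → V) : ℝ → ℝ := glue fun j x =>
  ∑ i ∈ Finset.range j, angle (v i) (v (i + 1))
    + angle (v j) (AffineMap.lineMap (v j) (v (j + 1)) x)

theorem polygonCurve_eq (v : ℕ → V) {j : ℕ} {s : ℝ} (h1 : j ≤ s) (h2 : s ≤ j + 1) :
    polygonCurve v s = AffineMap.lineMap (v j) (v (j + 1)) (s - j) :=
  glue_eq (g := fun j x => AffineMap.lineMap (v j) (v (j + 1)) x) (fun j => by simp) h1 h2

theorem polygonCurve_natCast (v : ℕ → V) (j : ℕ) : polygonCurve v j = v j := by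
  rw [polygonCurve_eq v le_rfl (by linarith)]; simp

theorem polygonAngle_eq {v : ℕ → V} (hv : ∀ j, v j ≠ 0) {j : ℕ} {s : ℝ} (h1 : j ≤ s)
    (h2 : s ≤ j + 1) : polygonAngle v s = ∑ i ∈ Finset.range j, angle (v i) (v (i + 1))
      + angle (v j) (AffineMap.lineMap (v j) (v (j + 1)) (s - j)) :=
  glue_eq (g := fun j x => ∑ i ∈ Finset.range j, angle (v i) (v (i + 1))
    + angle (v j) (AffineMap.lineMap (v j) (v (j + 1)) x))
    (fun j => by simp [Finset.sum_range_succ, InnerProductGeometry.angle_self (hv (j + 1))]) h1 h2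

/-- The intermediate point is a nonnegative combination of `p` and the later point, so angles along
an edge add up. -/
theorem angle_lineMap_add {p q : V} (h0 : ∀ x ∈ segment ℝ p q, x ≠ 0) {x x' : ℝ} (hx : 0 ≤ x)
    (hxx : x ≤ x') (hx' : x' ≤ 1) :
    angle p (AffineMap.lineMap p q x') = angle p (AffineMap.lineMap p q x)
      + angle (AffineMap.lineMap p q x) (AffineMap.lineMap p q x') := by
  refine (InnerProductGeometry.angle_eq_angle_add_angle_iff
    (h0 _ (lineMap_mem_segment ℝ p q ⟨hx, hxx.trans hx'⟩))).2 (.inr ?_)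
  rw [Submodule.mem_span_pair]
  rcases (hx.trans hxx).eq_or_lt with h | h
  · have : x = 0 := by linarith
    subst this
    exact ⟨1, 0, by simp⟩
  · refine ⟨⟨1 - x / x', sub_nonneg.2 ((div_le_one h).2 hxx)⟩, ⟨x / x', by positivity⟩, ?_⟩
    change (1 - x / x') • p + (x / x') • AffineMap.lineMap p q x' = AffineMap.lineMap p q x
    rw [AffineMap.lineMap_apply_module, AffineMap.lineMap_apply_module]
    match_scalars <;> field_simp; ring

/-- With two sides of a triangle fixed, a smaller enclosed angle gives a shorter third side. -/
theorem norm_polarCurve_sub_le_of_angle_eq {c : ℝ → V} {T f : ℝ → ℝ}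
    (hf : ∀ t t', |f t - f t'| ≤ |t - t'|) {s s' : ℝ}
    (h : angle (c s) (c s') = T s' - T s) :
    ‖polarCurve c T f s' - polarCurve c T f s‖ ≤ ‖c s' - c s‖ := by
  refine abs_le_of_sq_le_sq' ?_ (norm_nonneg _) |>.2
  have hT : 0 ≤ T s' - T s := h ▸ InnerProductGeometry.angle_nonneg _ _
  have hcos : cos (angle (c s) (c s')) ≤ cos (f (T s') - f (T s)) := by
    rw [← cos_abs (f (T s') - f (T s))]
    refine cos_le_cos_of_nonneg_of_le_pi (abs_nonneg _) (InnerProductGeometry.angle_le_pi _ _) ?_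
    rw [h, ← abs_of_nonneg hT]; exact hf _ _
  rw [Complex.sq_norm, Complex.normSq_apply, norm_sub_sq_real, real_inner_comm,
    ← InnerProductGeometry.cos_angle_mul_norm_mul_norm]
  simp only [polarCurve, Complex.sub_re, Complex.sub_im]
  have hm := mul_le_mul_of_nonneg_left hcos (mul_nonneg (norm_nonneg (c s)) (norm_nonneg (c s')))
  rw [cos_sub] at hm
  have e1 := sin_sq_add_cos_sq (f (T s))
  have e2 := sin_sq_add_cos_sq (f (T s'))
  have : (‖c s'‖ * cos (f (T s')) - ‖c s‖ * cos (f (T s))) *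
        (‖c s'‖ * cos (f (T s')) - ‖c s‖ * cos (f (T s))) +
      (‖c s'‖ * sin (f (T s')) - ‖c s‖ * sin (f (T s))) *
        (‖c s'‖ * sin (f (T s')) - ‖c s‖ * sin (f (T s))) = ‖c s'‖ ^ 2 + ‖c s‖ ^ 2 - 2 *
      (‖c s‖ * ‖c s'‖ * (cos (f (T s')) * cos (f (T s)) + sin (f (T s')) * sin (f (T s)))) := by
    linear_combination ‖c s‖ ^ 2 * e1 + ‖c s'‖ ^ 2 * e2
  rw [this]; linarith

theorem isDeveloped_polygon {v : ℕ → V} {N : ℕ} (hN : 0 < N) (hper : ∀ n, v (n + N) = v n)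
    (h0 : ∀ n, ∀ x ∈ segment ℝ (v n) (v (n + 1)), x ≠ 0) :
    IsDeveloped (polygonCurve v) (polygonAngle v) (polygonLength v) N
      (∑ i ∈ Finset.range N, angle (v i) (v (i + 1)))
      (∑ i ∈ Finset.range N, dist (v i) (v (i + 1))) := by
  have hv : ∀ j, v j ≠ 0 := fun j => h0 j _ (left_mem_segment ℝ _ _)
  have hper' : ∀ n, v (n + N + 1) = v (n + 1) := fun n => by rw [add_right_comm, hper]
  have hloc : ∀ (j : ℕ) (s s' : ℝ), j ≤ s → s ≤ s' → s' ≤ j + 1 →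
      angle (polygonCurve v s) (polygonCurve v s') = polygonAngle v s' - polygonAngle v s := by
    intro j s s' h1 h2 h3
    rw [polygonCurve_eq v h1 (h2.trans h3), polygonCurve_eq v (h1.trans h2) h3,
      polygonAngle_eq hv h1 (h2.trans h3), polygonAngle_eq hv (h1.trans h2) h3,
      angle_lineMap_add (h0 j) (x := s - j) (x' := s' - j) (by linarith) (by linarith)
        (by linarith)]
    ring
  have hlen : ∀ (j : ℕ) (s s' : ℝ), j ≤ s → s ≤ s' → s' ≤ j + 1 →
      polygonLength v s' - polygonLength v s = (s' - s) * dist (v j) (v (j + 1)) := by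
    intro j s s' h1 h2 h3
    rw [polygonLength_eq v h1 (h2.trans h3), polygonLength_eq v (h1.trans h2) h3]; ring
  have hshift : ∀ {j : ℕ} {s : ℝ}, j ≤ s → s ≤ j + 1 →
      ((j + N : ℕ) : ℝ) ≤ s + N ∧ s + N ≤ ((j + N : ℕ) : ℝ) + 1 := by
    intro j s h1 h2; push_cast; constructor <;> linarith
  constructor
  · positivity
  · exact continuousOn_glue (fun j => by simp) fun j => AffineMap.lineMap_continuous.continuousOn
  · refine continuousOn_glue
      (fun j => by simp [Finset.sum_range_succ, InnerProductGeometry.angle_self (hv (j + 1))])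
      fun j x hx => ?_
    refine continuousWithinAt_const.add (ContinuousAt.continuousWithinAt ?_)
    have hc : ContinuousAt (fun x : ℝ => (v j, AffineMap.lineMap (v j) (v (j + 1)) x)) x :=
      (continuous_const.prodMk AffineMap.lineMap_continuous).continuousAt
    exact ContinuousAt.comp (f := fun x : ℝ => (v j, AffineMap.lineMap (v j) (v (j + 1)) x))
      (InnerProductGeometry.continuousAt_angle (hv j) (h0 j _ (lineMap_mem_segment ℝ _ _ hx))) hc
  · intro s hs
    obtain ⟨j, h1, h2⟩ := exists_nat_mem_Icc hs
    rw [polygonCurve_eq v h1 h2]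
    exact h0 j _ (lineMap_mem_segment ℝ _ _ ⟨by linarith, by linarith⟩)
  · intro s s' hs hss
    exact le_sub_of_local (d := fun s s' => angle (polygonCurve v s) (polygonCurve v s'))
      (fun _ _ _ => InnerProductGeometry.angle_le_angle_add_angle _ _ _)
      (fun j s s' h1 h2 h3 => (hloc j s s' h1 h2 h3).le) hs hss
  · intro f hf s s' hs hss
    refine le_sub_of_local (d := fun s s' => ‖polarCurve (polygonCurve v) (polygonAngle v) f s'
      - polarCurve (polygonCurve v) (polygonAngle v) f s‖) (fun s s' s'' => ?_)
      (fun j s s' h1 h2 h3 => ?_) hs hss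
    · rw [add_comm]; exact norm_sub_le_norm_sub_add_norm_sub _ _ _
    · refine (norm_polarCurve_sub_le_of_angle_eq hf (hloc j s s' h1 h2 h3)).trans (le_of_eq ?_)
      rw [hlen j s s' h1 h2 h3, ← dist_eq_norm, polygonCurve_eq v h1 (h2.trans h3),
        polygonCurve_eq v (h1.trans h2) h3, dist_lineMap_lineMap, Real.dist_eq,
        abs_of_nonneg (by linarith)]
      ring
  · refine ⟨∑ i ∈ Finset.range N, dist (v i) (v (i + 1)), fun s s' hs hss => ?_⟩
    refine (le_sub_of_local (d := fun s s' => polygonLength v s' - polygonLength v s)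
      (H := fun s => (∑ i ∈ Finset.range N, dist (v i) (v (i + 1))) * s)
      (fun s s' s'' => by linarith) (fun j s s' h1 h2 h3 => ?_) hs hss).trans (le_of_eq (by ring))
    rw [hlen j s s' h1 h2 h3]
    have hp : Function.Periodic (fun i => dist (v i) (v (i + 1))) N := fun i => by
      simp only [hper, hper']
    have : dist (v j) (v (j + 1)) ≤ ∑ i ∈ Finset.range N, dist (v i) (v (i + 1)) := by
      rw [← hp.map_mod_nat j]
      exact Finset.single_le_sum (f := fun i => dist (v i) (v (i + 1))) (fun _ _ => dist_nonneg)
        (Finset.mem_range.2 (Nat.mod_lt j hN))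
    nlinarith
  · intro s hs
    obtain ⟨j, h1, h2⟩ := exists_nat_mem_Icc hs
    rw [polygonCurve_eq v h1 h2, polygonCurve_eq v (hshift h1 h2).1 (hshift h1 h2).2, hper, hper']
    congr 1; push_cast; ring
  · intro s hs
    obtain ⟨j, h1, h2⟩ := exists_nat_mem_Icc hs
    rw [polygonAngle_eq hv h1 h2, polygonAngle_eq hv (hshift h1 h2).1 (hshift h1 h2).2, hper, hper',
      sum_range_add_period (g := fun i => angle (v i) (v (i + 1)))
        (fun n => by simp only [hper, hper'])]
    push_cast
    rw [add_sub_add_right_eq_sub]; ring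
  · intro s hs
    obtain ⟨j, h1, h2⟩ := exists_nat_mem_Icc hs
    rw [polygonLength_eq v h1 h2, polygonLength_eq v (hshift h1 h2).1 (hshift h1 h2).2, hper, hper',
      sum_range_add_period (g := fun i => dist (v i) (v (i + 1)))
        (fun n => by simp only [hper, hper'])]
    push_cast; ring

/-! ### Cone angle and the length bound for closed polygons -/

theorem inner_add_normalize_pos {p x y : V} (hp : p ≠ 0) (hx : x ≠ 0) (hy : y ≠ 0)
    (h : angle p x + angle p y < π) : 0 < inner ℝ p (‖x‖⁻¹ • x + ‖y‖⁻¹ • y) := by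
  have hcos : cos (π - angle p x) < cos (angle p y) := by
    refine cos_lt_cos_of_nonneg_of_le_pi (InnerProductGeometry.angle_nonneg _ _) ?_ (by linarith)
    linarith [InnerProductGeometry.angle_nonneg p x]
  rw [cos_pi_sub] at hcos
  rw [inner_add_right, inner_smul_right, inner_smul_right,
    ← InnerProductGeometry.cos_angle_mul_norm_mul_norm,
    ← InnerProductGeometry.cos_angle_mul_norm_mul_norm]
  have h1 := norm_pos_iff.2 hp
  have h2 := norm_ne_zero_iff.2 hx
  have h3 := norm_ne_zero_iff.2 hy
  have e : ‖x‖⁻¹ * (cos (angle p x) * (‖p‖ * ‖x‖)) + ‖y‖⁻¹ * (cos (angle p y) * (‖p‖ * ‖y‖))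
      = ‖p‖ * (cos (angle p x) + cos (angle p y)) := by field_simp
  rw [e]
  exact mul_pos h1 (by linarith)

/-- The cone over a closed curve has cone angle at least `2π` if its apex lies in the convex hull. -/
theorem IsDeveloped.two_pi_le {c : ℝ → V} {T l : ℝ → ℝ} {N Θ L : ℝ}
    (h : IsDeveloped c T l N Θ L) (h0 : (0 : V) ∈ convexHull ℝ (c '' Icc 0 N)) : 2 * π ≤ Θ := by
  by_contra! hlt
  have hN := h.period_nonneg
  have hTN := h.angle_period 0 le_rfl
  have hcN := h.periodic 0 le_rfl
  rw [zero_add] at hTN hcN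
  have hΘ : 0 ≤ Θ := by linarith [h.monotoneOn (mem_Ici.2 le_rfl) (mem_Ici.2 hN) hN]
  -- The parameter u halves the swept angle. If Θ < 2π, every curve point makes angles with `c 0`
  -- and `c u` of sum below π, so the curve lies in an open half-space bounded by a plane through
  -- the apex.
  obtain ⟨u, hu, hTu⟩ := h.exists_angle_eq le_rfl hN (t := T 0 + Θ / 2) (by linarith)
    (by linarith)
  set w := ‖c 0‖⁻¹ • c 0 + ‖c u‖⁻¹ • c u with hw
  have hsub : c '' Icc 0 N ⊆ {p | 0 < inner ℝ p w} := by
    rintro _ ⟨s, hs, rfl⟩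
    refine inner_add_normalize_pos (h.ne_zero s hs.1) (h.ne_zero 0 le_rfl) (h.ne_zero u hu.1) ?_
    rcases le_total s u with hsu | hsu
    · have e1 := h.angle_le 0 s le_rfl hs.1
      have e2 := h.angle_le s u hs.1 hsu
      rw [InnerProductGeometry.angle_comm] at e1
      linarith
    · have e1 := h.angle_le u s hu.1 hsu
      have e2 := h.angle_le s N hs.1 hs.2
      rw [hcN] at e2
      rw [InnerProductGeometry.angle_comm] at e1
      linarith
  have hconv : Convex ℝ {p : V | 0 < inner ℝ p w} :=
    convex_halfSpace_gt ⟨fun x y => inner_add_left x y w, fun a x => by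
      rw [real_inner_smul_left]; rfl⟩ 0
  have := convexHull_min hsub hconv h0
  simp at this

/-- A closed polygon at distance at least `ρ` from two points `a`, `b` of its cone with apex `0`
(a point of its convex hull) has length at least `2πρ + 2|a - b|`. -/
theorem le_length_of_closed_polygon {v : ℕ → V} {N : ℕ} (hN : 0 < N)
    (hper : ∀ n, v (n + N) = v n) {a b : V} {ρ : ℝ} (hρ : 0 ≤ ρ)
    (h0 : ∀ n, ∀ x ∈ segment ℝ (v n) (v (n + 1)), x ≠ 0 ∧ ρ ≤ dist x a ∧ ρ ≤ dist x b)
    (hconv : (0 : V) ∈ convexHull ℝ (range v))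
    (ha : ∃ n, ∃ x ∈ segment ℝ (v n) (v (n + 1)), ∃ y ∈ Icc (0 : ℝ) 1, a = y • x)
    (hb : ∃ n, ∃ x ∈ segment ℝ (v n) (v (n + 1)), ∃ y ∈ Icc (0 : ℝ) 1, b = y • x) :
    2 * π * ρ + 2 * dist a b ≤ ∑ i ∈ Finset.range N, dist (v i) (v (i + 1)) := by
  have h := isDeveloped_polygon hN hper fun n x hx => (h0 n x hx).1
  have hp : Function.Periodic v N := hper
  have hΘ := h.two_pi_le (convexHull_mono (by
    rintro _ ⟨n, rfl⟩
    refine ⟨((n % N : ℕ) : ℝ), ⟨by positivity, by exact_mod_cast (Nat.mod_lt n hN).le⟩, ?_⟩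
    rw [polygonCurve_natCast, hp.map_mod_nat]) hconv)
  have hpar : ∀ {a : V}, (∃ n, ∃ x ∈ segment ℝ (v n) (v (n + 1)), ∃ y ∈ Icc (0 : ℝ) 1, a = y • x) →
      ∃ s ∈ Icc (0 : ℝ) N, ∃ y ∈ Icc (0 : ℝ) 1, a = y • polygonCurve v s := by
    rintro a ⟨n, x, hx, y, hy, rfl⟩
    have hp' : Function.Periodic (fun i => v (i + 1)) N := fun i => by
      change v (i + N + 1) = v (i + 1)
      rw [add_right_comm, hper]
    rw [← hp.map_mod_nat n, ← hp'.map_mod_nat n, segment_eq_image_lineMap] at hx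
    obtain ⟨t, ht, rfl⟩ := hx
    refine ⟨(n % N : ℕ) + t, ⟨by linarith [ht.1, (n % N).cast_nonneg (α := ℝ)], ?_⟩, y, hy, ?_⟩
    · have : ((n % N + 1 : ℕ) : ℝ) ≤ N := by exact_mod_cast Nat.mod_lt n hN
      push_cast at this
      linarith [ht.2]
    · rw [polygonCurve_eq v (j := n % N) (by linarith [ht.1]) (by linarith [ht.2])]; simp
  have hd : ∀ s, 0 ≤ s → ρ ≤ dist (polygonCurve v s) a ∧ ρ ≤ dist (polygonCurve v s) b := by
    intro s hs
    obtain ⟨j, h1, h2⟩ := exists_nat_mem_Icc hs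
    rw [polygonCurve_eq v h1 h2]
    exact (h0 j _ (lineMap_mem_segment ℝ _ _ ⟨by linarith, by linarith⟩)).2
  obtain ⟨sa, hsa, ya, hya, rfl⟩ := hpar ha
  obtain ⟨sb, hsb, yb, hyb, rfl⟩ := hpar hb
  clear ha hb h0
  wlog hab : sa ≤ sb generalizing sa sb ya yb
  · rw [dist_comm]
    exact this sb hsb yb hyb sa hsa ya hya (fun s hs => (hd s hs).symm) (le_of_not_ge hab)
  have hN0 := h.period_nonneg
  have pa := h.periodic sa hsa.1
  have pb := h.periodic sb hsb.1
  have pa' := h.periodic (sa + N) (by linarith [hsa.1])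
  have ta := h.angle_period sa hsa.1
  have tb := h.angle_period sb hsb.1
  have ta' := h.angle_period (sa + N) (by linarith [hsa.1])
  -- The three cases: the arc from a to b subtends at most π, the complementary arc does, or
  -- neither. The shift by a period leaves room for the parameter window on the left.
  by_cases c1 : polygonAngle v sb - polygonAngle v sa ≤ π
  · have := h.le_length_of_le_pi (sa := sa + N) (sb := sb + N) (ya := ya) (yb := yb) (ρ := ρ)
      (by linarith [hsa.1]) (by linarith) (by linarith [hsb.2, hsa.1]) hya hyb hρ
      (by rw [pa]; exact fun s hs => (hd s hs).1) (by rw [pb]; exact fun s hs => (hd s hs).2) hΘ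
      (by rw [ta, tb]; linarith)
    rwa [pa, pb] at this
  by_cases c2 : ∑ i ∈ Finset.range N, angle (v i) (v (i + 1))
      - (polygonAngle v sb - polygonAngle v sa) ≤ π
  · have := h.le_length_of_le_pi (sa := sb + N) (sb := sa + N + N) (ya := yb) (yb := ya) (ρ := ρ)
      (by linarith [hsb.1]) (by linarith [hsa.1, hsb.2]) (by linarith) hyb hya hρ
      (by rw [pb]; exact fun s hs => (hd s hs).2)
      (by rw [pa', pa]; exact fun s hs => (hd s hs).1) hΘ
      (by rw [ta', ta, tb]; linarith)
    rwa [pa', pa, pb, dist_comm] at this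
  · have := h.le_length_of_pi_le (sa := sa + N) (sb := sb + N) (ya := ya) (yb := yb) (ρ := ρ)
      (by linarith [hsa.1]) (by linarith) (by linarith [hsb.2, hsa.1]) hya hyb hρ
      (by rw [pa]; exact fun s hs => (hd s hs).1) (by rw [pb]; exact fun s hs => (hd s hs).2)
      (by rw [ta, tb]; linarith) (by rw [ta, tb]; linarith)
    rwa [pa, pb] at this

end

/-! ### Tents over the gaps -/

noncomputable section

open Set Real Filter Topology

/-- The Taylor bound gives sin 2t ≤ 2t - t³/2, and adding t³/2 to the argument raises the sine by at
most t³/2. -/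
theorem add_cube_le_phi {t : ℝ} (h0 : 0 ≤ t) (h1 : t ≤ 1 / 2) : t + t ^ 3 / 2 ≤ phi t := by
  have h3 : 0 ≤ t ^ 3 := by positivity
  have h3' : t ^ 3 ≤ (1 / 2) ^ 3 := pow_le_pow_left₀ h0 h1 3
  have hb := (abs_le.1 (sin_bound (x := 2 * t) (by rw [abs_of_nonneg (by linarith)]; linarith))).2
  rw [abs_of_nonneg (by linarith)] at hb
  have h4 : t ^ 4 ≤ t ^ 3 := by nlinarith
  have hs : sin (2 * t) ≤ 2 * t - t ^ 3 / 2 := by nlinarith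
  have hs0 : 0 ≤ sin (2 * t) :=
    sin_nonneg_of_nonneg_of_le_pi (by linarith) (by linarith [pi_gt_three])
  have hadd : sin (2 * t + t ^ 3 / 2) ≤ sin (2 * t) + t ^ 3 / 2 := by
    rw [sin_add]
    have a1 := mul_le_of_le_one_right hs0 (cos_le_one (t ^ 3 / 2))
    have a2 : sin (t ^ 3 / 2) ≤ t ^ 3 / 2 := sin_le (by positivity)
    have a3 : 0 ≤ sin (t ^ 3 / 2) :=
      sin_nonneg_of_nonneg_of_le_pi (by positivity) (by linarith [pi_gt_three])
    have a4 := mul_le_of_le_one_left a3 (cos_le_one (2 * t))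
    linarith
  have := (le_arcsin_iff_sin_le (x := 2 * t + t ^ 3 / 2) (y := 2 * t)
    ⟨by linarith [pi_gt_three], by linarith [pi_gt_three]⟩ ⟨by linarith, by linarith⟩).2
    (by linarith)
  unfold phi
  linarith

variable {V : Type*} [NormedAddCommGroup V] [InnerProductSpace ℝ V]

/-- Moving one endpoint outwards along its ray moves the segment away from the origin, so the cone
over it still contains the old segment. -/
theorem exists_mem_segment_smul {p n x : V} (hx : x ∈ segment ℝ p n) {r : ℝ} (hr : 1 ≤ r) :
    ∃ x' ∈ segment ℝ p (r • n), ∃ y ∈ Icc (0 : ℝ) 1, x = y • x' := by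
  rw [segment_eq_image] at hx
  obtain ⟨s, hs, rfl⟩ := hx
  have hr0 : 0 < r := by linarith
  have h1 : s / r ≤ s := div_le_self hs.1 hr
  have h2 : 0 ≤ s / r := div_nonneg hs.1 hr0.le
  have hy : 0 < s / r + (1 - s) := by
    rcases hs.2.eq_or_lt with rfl | h
    · have : 0 < 1 / r := by positivity
      linarith
    · linarith
  refine ⟨((1 - s) / (s / r + (1 - s))) • p + (s / r / (s / r + (1 - s))) • (r • n),
    ⟨_, _, div_nonneg (by linarith [hs.2]) hy.le, div_nonneg h2 hy.le, ?_, rfl⟩,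
    s / r + (1 - s), ⟨hy.le, by linarith⟩, ?_⟩
  · rw [← add_div, add_comm, div_self hy.ne']
  · rw [smul_add, smul_smul, smul_smul, smul_smul, mul_div_cancel₀ _ hy.ne',
      mul_div_cancel₀ _ hy.ne', div_mul_cancel₀ _ hr0.ne']

theorem mem_segment_midpoint_or {p q x : V} (hx : x ∈ segment ℝ p q) :
    x ∈ segment ℝ p (midpoint ℝ p q) ∨ x ∈ segment ℝ q (midpoint ℝ p q) := by
  rw [segment_eq_image] at hx
  obtain ⟨s, hs, rfl⟩ := hx
  simp only [midpoint_eq_smul_add]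
  rcases le_total s (1 / 2) with h | h
  · left
    refine ⟨1 - 2 * s, 2 * s, by linarith, by linarith [hs.1], by ring, ?_⟩
    match_scalars <;> norm_num <;> ring
  · right
    refine ⟨2 * s - 1, 2 * (1 - s), by linarith, by linarith [hs.2], by ring, ?_⟩
    match_scalars <;> norm_num <;> ring

/-- The midpoint of `p` and `q`, moved away from the origin by `|p - q|² / 2`. -/
def tentPoint (p q : V) : V :=
  (1 + dist p q ^ 2 / 2 / ‖midpoint ℝ p q‖) • midpoint ℝ p q

theorem tentPoint_comm (p q : V) : tentPoint p q = tentPoint q p := by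
  rw [tentPoint, tentPoint, midpoint_comm, dist_comm]

theorem exists_mem_tent {p q x : V} (hx : x ∈ segment ℝ p q) :
    ∃ x', (x' ∈ segment ℝ p (tentPoint p q) ∨ x' ∈ segment ℝ (tentPoint p q) q) ∧
      ∃ y ∈ Icc (0 : ℝ) 1, x = y • x' := by
  have hr : 1 ≤ 1 + dist p q ^ 2 / 2 / ‖midpoint ℝ p q‖ := by
    linarith [show 0 ≤ dist p q ^ 2 / 2 / ‖midpoint ℝ p q‖ by positivity]
  rcases mem_segment_midpoint_or hx with h | h
  · obtain ⟨x', h1, h2⟩ := exists_mem_segment_smul h hr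
    exact ⟨x', .inl h1, h2⟩
  · obtain ⟨x', h1, h2⟩ := exists_mem_segment_smul h hr
    exact ⟨x', .inr (segment_symm ℝ q _ ▸ h1), h2⟩

theorem tentPoint_eq (p q : V) : tentPoint p q = midpoint ℝ p q
    + (dist p q ^ 2 / 2) • (‖midpoint ℝ p q‖⁻¹ • midpoint ℝ p q) := by
  rw [tentPoint, add_smul, one_smul, smul_smul, div_eq_mul_inv]

theorem norm_inv_norm_smul_le (x : V) : ‖‖x‖⁻¹ • x‖ ≤ 1 := by
  rw [norm_smul, norm_inv, norm_norm]
  exact inv_mul_le_one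

theorem dist_tentPoint_add_le (p q : V) :
    dist p (tentPoint p q) + dist (tentPoint p q) q ≤ dist p q + dist p q ^ 3 / 2 := by
  have hw := norm_inv_norm_smul_le (midpoint ℝ p q)
  rw [tentPoint_eq]
  set w := ‖midpoint ℝ p q‖⁻¹ • midpoint ℝ p q
  set d := dist p q with hd
  have e1 : p - (midpoint ℝ p q + (d ^ 2 / 2) • w) = (1 / 2 : ℝ) • (p - q) - (d ^ 2 / 2) • w := by
    rw [midpoint_eq_smul_add]; match_scalars <;> norm_num
  have e2 : midpoint ℝ p q + (d ^ 2 / 2) • w - q = (1 / 2 : ℝ) • (p - q) + (d ^ 2 / 2) • w := by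
    rw [midpoint_eq_smul_add]; match_scalars <;> norm_num
  rw [dist_eq_norm p, dist_eq_norm _ q, e1, e2]
  have hp := parallelogram_law_with_norm ℝ ((1 / 2 : ℝ) • (p - q)) ((d ^ 2 / 2) • w)
  have hn1 : ‖(1 / 2 : ℝ) • (p - q)‖ = d / 2 := by
    rw [norm_smul, ← dist_eq_norm, ← hd]; norm_num; ring
  have hn2 : ‖(d ^ 2 / 2) • w‖ ≤ d ^ 2 / 2 := by
    rw [norm_smul, Real.norm_of_nonneg (by positivity)]
    exact mul_le_of_le_one_right (by positivity) hw
  have hd0 : 0 ≤ d := dist_nonneg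
  set A := ‖(1 / 2 : ℝ) • (p - q) + (d ^ 2 / 2) • w‖
  set B := ‖(1 / 2 : ℝ) • (p - q) - (d ^ 2 / 2) • w‖
  rw [hn1] at hp
  -- (A + B)² ≤ 2(A² + B²) ≤ d² + d⁴, by the parallelogram law.
  have hsq : (B + A) ^ 2 ≤ (d + d ^ 3 / 2) ^ 2 := by
    have h2 := mul_self_le_mul_self (norm_nonneg _) hn2
    have h6 : 0 ≤ d ^ 6 := by positivity
    nlinarith [sq_nonneg (A - B)]
  exact (abs_le_of_sq_le_sq' hsq (by positivity)).2

/-- The chord dips into the unit ball around `a`: its squared distance may drop by (s/2)(1 - s/2)d².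
The outward push makes an angle with the chord point seen from `a` whose inner product is at least
1/2, and so restores at least s·d²/2. -/
theorem one_le_dist_of_mem_segment_tentPoint {p q a x : V} (ha : ‖a‖ < 1 / 2) (hp : 1 ≤ dist p a)
    (hq : 1 ≤ dist q a) (hpq : dist p q ≤ 1 / 2) (hx : x ∈ segment ℝ p (tentPoint p q)) :
    1 ≤ dist x a := by
  rw [segment_eq_image] at hx
  obtain ⟨s, hs, rfl⟩ := hx
  rw [tentPoint_eq]
  set n := midpoint ℝ p q with hn
  set w := ‖n‖⁻¹ • n with hw
  set d := dist p q with hd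
  obtain ⟨P, hP⟩ : ∃ P, P = p - a := ⟨_, rfl⟩
  obtain ⟨Q, hQ⟩ : ∃ Q, Q = q - a := ⟨_, rfl⟩
  rw [dist_eq_norm, ← hP] at hp
  rw [dist_eq_norm, ← hQ] at hq
  have hd0 : 0 ≤ d := dist_nonneg
  have hPQ : ‖P - Q‖ = d := by rw [hP, hQ, hd, dist_eq_norm]; congr 1; abel
  have hP2 : 1 ≤ ‖P‖ ^ 2 := one_le_pow₀ hp
  have hQ2 : 1 ≤ ‖Q‖ ^ 2 := one_le_pow₀ hq
  have hi := norm_sub_sq_real P Q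
  rw [hPQ] at hi
  have hcomb : ∀ t : ℝ, ‖(1 - t) • P + t • Q‖ ^ 2
      = (1 - t) * ‖P‖ ^ 2 + t * ‖Q‖ ^ 2 - t * (1 - t) * d ^ 2 := by
    intro t
    rw [norm_add_sq_real, norm_smul, norm_smul, inner_smul_left, inner_smul_right, mul_pow,
      mul_pow, Real.norm_eq_abs, Real.norm_eq_abs, sq_abs, sq_abs, hi]
    simp; ring
  have hna : n - a = (1 - 1 / 2 : ℝ) • P + (1 / 2 : ℝ) • Q := by
    rw [hn, hP, hQ, midpoint_eq_smul_add]; match_scalars <;> norm_num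
  have hna2 : 15 / 16 ≤ ‖n - a‖ ^ 2 := by rw [hna, hcomb]; nlinarith
  have hn0 : 0 < ‖n‖ := by
    by_contra! h
    have : n = 0 := norm_le_zero_iff.1 h
    rw [this, zero_sub, norm_neg] at hna2
    nlinarith [norm_nonneg a]
  have hw1 : ‖w‖ ≤ 1 := norm_inv_norm_smul_le n
  -- Twice the inner product of n - a and n is at least ‖n‖² + 15/16 - 1/4, which exceeds (3/2)‖n‖
  -- by completing the square at 3/4.
  have hnaw : 3 / 4 ≤ inner ℝ (n - a) w := by
    have e := norm_sub_sq_real n (n - a)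
    rw [sub_sub_cancel] at e
    rw [hw, inner_smul_right, real_inner_comm, inv_mul_eq_div, le_div_iff₀ hn0]
    nlinarith [norm_nonneg a, sq_nonneg (‖n‖ - 3 / 4)]
  have hy : 1 / 2 ≤ inner ℝ ((1 - s / 2) • P + (s / 2) • Q) w := by
    have e : (1 - s / 2) • P + (s / 2) • Q = (n - a) + ((1 - s) / 2) • (P - Q) := by
      rw [hna]; match_scalars <;> ring
    rw [e, inner_add_left, inner_smul_left]
    have h1 : |inner ℝ (P - Q) w| ≤ d := by
      refine (abs_real_inner_le_norm _ _).trans ?_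
      rw [hPQ]; exact mul_le_of_le_one_right hd0 hw1
    have h2 := (abs_le.1 h1).1
    simp only [conj_trivial]
    nlinarith [hs.1, hs.2]
  have e : (1 - s) • p + s • (n + (d ^ 2 / 2) • w) - a
      = ((1 - s / 2) • P + (s / 2) • Q) + (s * (d ^ 2 / 2)) • w := by
    rw [hn, hP, hQ, midpoint_eq_smul_add]; match_scalars <;> norm_num <;> ring
  have hs2 : 0 ≤ s * (d ^ 2 / 2) := mul_nonneg hs.1 (by positivity)
  simp only
  rw [dist_eq_norm, e, ← one_le_sq_iff₀ (norm_nonneg _), norm_add_sq_real, hcomb, inner_smul_right]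
  have hs1 := hs.1
  have hs' := hs.2
  have m1 : 0 ≤ (1 - s / 2) * (‖P‖ ^ 2 - 1) := mul_nonneg (by linarith) (by linarith)
  have m2 : 0 ≤ s / 2 * (‖Q‖ ^ 2 - 1) := mul_nonneg (by linarith) (by linarith)
  have m3 := mul_le_mul_of_nonneg_left hy hs2
  have m4 : 0 ≤ (s / 2) ^ 2 * d ^ 2 := by positivity
  nlinarith [sq_nonneg ‖(s * (d ^ 2 / 2)) • w‖]

theorem range_interpolatedClosedCurve_subset {k : ℕ} [NeZero k] (C : Fin k → C(I, E3)) :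
    range (interpolatedClosedCurve C) ⊆
      (⋃ i, range (C i)) ∪ ⋃ i, segment ℝ (C i 1) (C (i + 1) 0) := by
  have hsucc : ∀ n, Fin.ofNat k (n + 1) = Fin.ofNat k n + 1 := fun n => by
    ext; simp [Fin.val_add]
  have key : ∀ n, range (partialInterpolation C n) ⊆
      (⋃ i, range (C i)) ∪ ⋃ i, segment ℝ (C i 1) (C (i + 1) 0) := by
    intro n
    induction n with
    | zero =>
      rintro _ ⟨t, rfl⟩
      exact .inl (mem_iUnion.2 ⟨0, 0, rfl⟩)
    | succ n ih =>
      rw [partialInterpolation, Path.trans_range, Path.trans_range, Path.range_segment]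
      refine union_subset (union_subset ih ?_) ?_
      · exact fun x hx => .inl (mem_iUnion.2 ⟨Fin.ofNat k n, hx⟩)
      · rw [hsucc]
        exact fun x hx => .inr (mem_iUnion.2 ⟨Fin.ofNat k n, hx⟩)
  exact key k

end

/-! ### Subdivisions and cyclic polygons -/

noncomputable section

open Set Real Filter Topology

theorem exists_monotone_insert {δ : ℝ} {u : ℕ → I} {M : ℕ} (hu : Monotone u) (h0 : u 0 = 0)
    (h1 : u M = 1) (hd : ∀ n, dist (u n) (u (n + 1)) < δ) (x : I) :
    ∃ (u' : ℕ → I) (M' : ℕ), Monotone u' ∧ u' 0 = 0 ∧ u' M' = 1 ∧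
      (∀ n, dist (u' n) (u' (n + 1)) < δ) ∧ (∀ n ≤ M, ∃ n' ≤ M', u' n' = u n) ∧
      ∃ n' ≤ M', u' n' = x := by
  classical
  by_cases hx : ∃ n, x < u n
  · obtain ⟨j, hj, hjx⟩ : ∃ j, u j ≤ x ∧ x < u (j + 1) := by
      have hs := Nat.find_spec hx
      obtain ⟨j, hj⟩ : ∃ j, Nat.find hx = j + 1 := by
        refine Nat.exists_eq_succ_of_ne_zero fun h => ?_
        rw [h, h0] at hs
        exact absurd x.2.1 (not_le.2 hs)
      exact ⟨j, not_lt.1 (Nat.find_min hx (by omega)), hj ▸ hs⟩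
    have hjM : j < M := by
      by_contra! h
      have := h1 ▸ hu h
      exact absurd (lt_of_le_of_lt (this.trans hj) hjx) (not_lt.2 (u (j + 1)).2.2)
    have dj := hd j
    rw [Subtype.dist_eq, Real.dist_eq, abs_sub_comm] at dj
    have dj' := (abs_lt.1 dj).2
    have hj' : (u j : ℝ) ≤ x := hj
    have hjx' : (x : ℝ) < u (j + 1) := hjx
    have e1 : ∀ n, n ≤ j → (fun n => if n ≤ j then u n else if n = j + 1 then x else u (n - 1)) n
        = u n := fun n hn => by simp [hn]
    refine ⟨fun n => if n ≤ j then u n else if n = j + 1 then x else u (n - 1), M + 1, ?_, ?_, ?_, ?_,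
      ?_, j + 1, by omega, by simp⟩
    · refine monotone_nat_of_le_succ fun n => ?_
      rcases lt_trichotomy n j with h | rfl | h
      · simp only [h.le, if_true, Nat.succ_le_of_lt h]; exact hu n.le_succ
      · simpa using hj
      · rcases eq_or_ne n (j + 1) with rfl | h'
        · simpa using hjx.le
        · have a1 : ¬ n ≤ j := by omega
          have a2 : ¬ n + 1 ≤ j := by omega
          have a3 : ¬ n + 1 = j + 1 := by omega
          simp only [a1, a2, a3, h', if_false]
          exact hu (by omega)
    · simpa using h0
    · have a1 : ¬ M + 1 ≤ j := by omega
      have a2 : ¬ M + 1 = j + 1 := by omega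
      simp only [a1, a2, if_false]
      exact h1
    · intro n
      rcases lt_trichotomy n j with h | rfl | h
      · simp only [h.le, if_true, Nat.succ_le_of_lt h]; exact hd n
      · simp only [le_refl, if_true, Nat.not_succ_le_self, if_false]
        rw [Subtype.dist_eq, Real.dist_eq, abs_sub_comm, abs_of_nonneg (by linarith)]
        linarith
      · rcases eq_or_ne n (j + 1) with rfl | h'
        · have a2 : ¬ j + 1 + 1 ≤ j := by omega
          have a3 : ¬ j + 1 + 1 = j + 1 := by omega
          simp only [Nat.not_succ_le_self, if_false, if_true, a2, a3]
          rw [Subtype.dist_eq, Real.dist_eq, abs_sub_comm, Nat.add_sub_cancel,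
            abs_of_nonneg (by linarith)]
          linarith
        · have a1 : ¬ n ≤ j := by omega
          have a2 : ¬ n + 1 ≤ j := by omega
          have a3 : ¬ n + 1 = j + 1 := by omega
          simp only [a1, a2, a3, h', if_false]
          have := hd (n - 1)
          rwa [show n - 1 + 1 = n + 1 - 1 by omega] at this
    · intro n hn
      rcases le_or_gt n j with h | h
      · exact ⟨n, by omega, by simp [h]⟩
      · refine ⟨n + 1, by omega, ?_⟩
        have a2 : ¬ n + 1 ≤ j := by omega
        have a3 : ¬ n + 1 = j + 1 := by omega
        simp only [a2, a3, if_false]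
        rfl
  · push Not at hx
    refine ⟨u, M, hu, h0, h1, hd, fun n hn => ⟨n, hn, rfl⟩, M, le_rfl, ?_⟩
    exact le_antisymm (hx M) (h1 ▸ x.2.2)

/-- A subdivision of the unit interval with small mesh that contains a given finite set. -/
theorem exists_subdivision {δ : ℝ} (hδ : 0 < δ) (F : Finset I) :
    ∃ (u : ℕ → I) (M : ℕ), Monotone u ∧ u 0 = 0 ∧ u M = 1 ∧
      (∀ n, dist (u n) (u (n + 1)) < δ) ∧ ∀ x ∈ F, ∃ n ≤ M, u n = x := by
  classical
  induction F using Finset.induction_on with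
  | empty =>
    obtain ⟨M, hM⟩ := exists_nat_one_div_lt hδ
    have hM0 : (0 : ℝ) < M + 1 := by positivity
    -- The projection makes the sequence constant from index M + 1 on.
    refine ⟨fun n => projIcc 0 1 zero_le_one ((n : ℝ) / (M + 1)), M + 1, ?_, ?_, ?_, ?_, by simp⟩
    · intro n n' h
      refine monotone_projIcc _ ?_
      gcongr
    · simp
    · exact projIcc_of_right_le _ (by push_cast; rw [div_self hM0.ne'])
    · intro n
      refine lt_of_le_of_lt ?_ hM
      rw [Subtype.dist_eq, Real.dist_eq]
      refine (abs_projIcc_sub_projIcc _).trans (le_of_eq ?_)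
      rw [← sub_div, abs_div, abs_of_pos hM0]
      congr 1
      push_cast
      rw [show (n : ℝ) - (n + 1) = -1 by ring]; simp
  | insert x F _ ih =>
    obtain ⟨u, M, hu, h0, h1, hd, hF⟩ := ih
    obtain ⟨u', M', hu', h0', h1', hd', hM, hx⟩ := exists_monotone_insert hu h0 h1 hd x
    refine ⟨u', M', hu', h0', h1', hd', fun y hy => ?_⟩
    rcases Finset.mem_insert.1 hy with rfl | hy
    · exact hx
    · obtain ⟨n, hn, rfl⟩ := hF y hy
      exact hM n hn

section Blocks

variable {X : Type*} {k : ℕ} [NeZero k]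

/-- The periodic sequence that runs cyclically through `k` blocks of length `K`. -/
def blockSeq (K : ℕ) (g : Fin k → ℕ → X) (n : ℕ) : X := g (Fin.ofNat k (n / K)) (n % K)

variable {K : ℕ} {g : Fin k → ℕ → X}

theorem blockSeq_add_period (hK : 0 < K) (n : ℕ) : blockSeq K g (n + k * K) = blockSeq K g n := by
  have h1 : (n + k * K) / K = n / K + k := Nat.add_mul_div_right _ _ hK
  have h2 : Fin.ofNat k (n / K + k) = Fin.ofNat k (n / K) := by ext; simp
  rw [blockSeq, blockSeq, h1, h2, Nat.add_mul_mod_self_right]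

theorem blockSeq_mul_add {q r : ℕ} (hr : r < K) :
    blockSeq K g (q * K + r) = g (Fin.ofNat k q) r := by
  have h1 : (q * K + r) / K = q := by
    rw [add_comm, Nat.add_mul_div_right _ _ (by omega), Nat.div_eq_of_lt hr, zero_add]
  rw [blockSeq, h1, add_comm, Nat.add_mul_mod_self_right, Nat.mod_eq_of_lt hr]

theorem blockSeq_mul_add_succ (hg : ∀ i, g i K = g (i + 1) 0) {q r : ℕ} (hr : r < K) :
    blockSeq K g (q * K + r + 1) = g (Fin.ofNat k q) (r + 1) := by
  rcases (Nat.succ_le_of_lt hr).eq_or_lt with h | h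
  · have e : q * K + r + 1 = (q + 1) * K + 0 := by rw [add_assoc, ← Nat.succ_eq_add_one r, h]; ring
    rw [e, blockSeq_mul_add (by omega), ← Nat.succ_eq_add_one r, h, hg]
    congr 1
    ext; simp [Fin.val_add]
  · rw [add_assoc, blockSeq_mul_add h]

theorem exists_blockSeq_edge (hK : 0 < K) (hg : ∀ i, g i K = g (i + 1) 0) (n : ℕ) :
    ∃ i, ∃ r < K, blockSeq K g n = g i r ∧ blockSeq K g (n + 1) = g i (r + 1) := by
  have h := Nat.mod_lt n hK
  refine ⟨Fin.ofNat k (n / K), n % K, h, rfl, ?_⟩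
  rw [← blockSeq_mul_add_succ hg h, Nat.div_add_mod']

theorem exists_blockSeq_edge_eq (hg : ∀ i, g i K = g (i + 1) 0) (i : Fin k) {r : ℕ} (hr : r < K) :
    ∃ n, blockSeq K g n = g i r ∧ blockSeq K g (n + 1) = g i (r + 1) := by
  refine ⟨i * K + r, ?_, ?_⟩
  · rw [blockSeq_mul_add hr]; simp
  · rw [blockSeq_mul_add_succ hg hr]; simp

theorem sum_range_mul (f : ℕ → ℝ) (q K : ℕ) : ∑ n ∈ Finset.range (q * K), f n
    = ∑ j ∈ Finset.range q, ∑ r ∈ Finset.range K, f (j * K + r) := by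
  induction q with
  | zero => simp
  | succ q ih => rw [Nat.succ_mul, Finset.sum_range_add, ih, Finset.sum_range_succ]

theorem sum_blockSeq_edge (hg : ∀ i, g i K = g (i + 1) 0) (d : X → X → ℝ) :
    ∑ n ∈ Finset.range (k * K), d (blockSeq K g n) (blockSeq K g (n + 1))
      = ∑ i, ∑ r ∈ Finset.range K, d (g i r) (g i (r + 1)) := by
  rw [sum_range_mul, Finset.sum_range]
  refine Finset.sum_congr rfl fun i _ => Finset.sum_congr rfl fun r hr => ?_
  have hr := Finset.mem_range.1 hr
  rw [blockSeq_mul_add hr, blockSeq_mul_add_succ hg hr]; simp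

end Blocks

/-! ### From curves to inscribed polygons -/

theorem sum_dist_le_curveLength {c : C(I, E3)} (hc : curveLength c ≠ ⊤) {u : ℕ → I}
    (hu : Monotone u) (M : ℕ) :
    ∑ r ∈ Finset.range M, dist (c (u r)) (c (u (r + 1))) ≤ (curveLength c).toReal := by
  have h := eVariationOn.sum_le (f := c) (s := univ) (n := M) hu fun _ => mem_univ _
  have h2 := ENNReal.toReal_mono hc h
  rw [ENNReal.toReal_sum fun _ _ => edist_ne_top _ _] at h2
  simpa only [edist_dist, ENNReal.toReal_ofReal dist_nonneg, dist_comm] using h2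

/-- Finitely many curve points suffice to span m, so an inscribed polygon through them keeps m in
its hull. -/
theorem exists_finset_mem_convexHull {k : ℕ} [NeZero k] {C : Fin k → C(I, E3)} {m : E3}
    (hm : m ∈ convexHull ℝ (range (interpolatedClosedCurve C))) :
    ∃ F : Finset I, m ∈ convexHull ℝ {x | ∃ i, ∃ s ∈ F, C i s = x} := by
  classical
  have hsub : range (interpolatedClosedCurve C) ⊆ convexHull ℝ (⋃ i, range (C i)) := by
    refine (range_interpolatedClosedCurve_subset C).trans (union_subset (subset_convexHull _ _) ?_)
    refine iUnion_subset fun i => (convex_convexHull ℝ _).segment_subset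
      (subset_convexHull _ _ (mem_iUnion.2 ⟨i, 1, rfl⟩))
      (subset_convexHull _ _ (mem_iUnion.2 ⟨i + 1, 0, rfl⟩))
  have h := convexHull_min hsub (convex_convexHull ℝ _) hm
  rw [convexHull_eq_union_convexHull_finite_subsets] at h
  simp only [mem_iUnion] at h
  obtain ⟨G, hG, hmG⟩ := h
  have hch : ∀ x : G, ∃ s : I, ∃ i, C i s = x := fun x => by
    obtain ⟨i, s, hs⟩ := mem_iUnion.1 (hG x.2)
    exact ⟨s, i, hs⟩
  choose s hs using hch
  refine ⟨Finset.univ.image s, convexHull_mono (fun x hx => ?_) hmG⟩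
  obtain ⟨i, hi⟩ := hs ⟨x, hx⟩
  exact ⟨i, _, Finset.mem_image_of_mem _ (Finset.mem_univ _), hi⟩

theorem exists_mem_cone {k : ℕ} [NeZero k] {C : Fin k → C(I, E3)} {m a : E3}
    (ha : a ∈ range (cone (interpolatedClosedCurve C) m)) :
    ∃ x, ∃ y ∈ Icc (0 : ℝ) 1, a - m = y • (x - m) ∧ ∃ i, ∃ s : I,
      x = C i s ∨ x ∈ segment ℝ (C i 1) (C (i + 1) 0) := by
  obtain ⟨⟨t, y⟩, rfl⟩ := ha
  refine ⟨interpolatedClosedCurve C t, y, y.2, ?_, ?_⟩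
  · simp only [cone]; match_scalars <;> ring
  · rcases range_interpolatedClosedCurve_subset C ⟨t, rfl⟩ with h | h
    · obtain ⟨i, s, hs⟩ := mem_iUnion.1 h
      exact ⟨i, s, .inl hs.symm⟩
    · obtain ⟨i, hi⟩ := mem_iUnion.1 h
      exact ⟨i, 0, .inr hi⟩

theorem le_sum_curveLength_add {k : ℕ} [NeZero k] (C : Fin k → C(I, E3))
    (hgap : ∀ i : Fin k, dist (C i 1) (C (i + 1) 0) ≤ 1 / 2) {m a b : E3}
    (hm : m ∈ convexHull ℝ (range (interpolatedClosedCurve C)))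
    (ha : a ∈ range (cone (interpolatedClosedCurve C) m))
    (hb : b ∈ range (cone (interpolatedClosedCurve C) m))
    (hda : ∀ i s, 1 ≤ dist (C i s) a) (hdb : ∀ i s, 1 ≤ dist (C i s) b)
    (ham : dist a m < 1 / 2) (hbm : dist b m < 1 / 2) (hfin : ∀ i, curveLength (C i) ≠ ⊤)
    {ε : ℝ} (hε : 0 < ε) (hε' : ε < 1 / 2) :
    2 * π * (1 - ε) + 2 * dist a b ≤ ∑ i, (curveLength (C i)).toReal
      + ∑ i, phi (dist (C i 1) (C (i + 1) 0)) := by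
  classical
  obtain ⟨δ, hδ, hunif⟩ : ∃ δ > 0, ∀ i, ∀ s s' : I, dist s s' < δ → dist (C i s) (C i s') < ε := by
    have h : ∀ i, ∃ δ > 0, ∀ s s' : I, dist s s' < δ → dist (C i s) (C i s') < ε := fun i => by
      obtain ⟨δ, hδ, h⟩ := Metric.uniformContinuous_iff.1
        (CompactSpace.uniformContinuous_of_continuous (C i).continuous) ε hε
      exact ⟨δ, hδ, fun s s' hs => h hs⟩
    choose δ hδ h using h
    refine ⟨Finset.univ.inf' Finset.univ_nonempty δ,
      (Finset.lt_inf'_iff _).2 fun i _ => hδ i, fun i s s' hs => h i s s' ?_⟩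
    exact hs.trans_le (Finset.inf'_le _ (Finset.mem_univ i))
  obtain ⟨F, hF⟩ := exists_finset_mem_convexHull hm
  obtain ⟨xa, ya, hya, ea, ia, sa, hxa⟩ := exists_mem_cone ha
  obtain ⟨xb, yb, hyb, eb, ib, sb, hxb⟩ := exists_mem_cone hb
  -- Including `sa`, `sb` and `F` among the vertices keeps a and b in the cone, and m in the convex
  -- hull, exactly and not just approximately.
  obtain ⟨u, M, hu, hu0, hu1, hud, huF⟩ := exists_subdivision hδ (insert sa (insert sb F))
  -- Block i has M inscribed edges and two tent edges. Index M + 2 repeats the first vertex of the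
  -- next block.
  set g : Fin k → ℕ → E3 := fun i r => if r ≤ M then C i (u r) - m else
    if r = M + 1 then tentPoint (C i 1 - m) (C (i + 1) 0 - m) else C (i + 1) 0 - m with hg
  have g1 : ∀ i r, r ≤ M → g i r = C i (u r) - m := fun i r h => by simp [hg, h]
  have g2 : ∀ i, g i (M + 1) = tentPoint (C i 1 - m) (C (i + 1) 0 - m) := fun i => by simp [hg]
  have g3 : ∀ i, g i (M + 2) = C (i + 1) 0 - m := fun i => by simp [hg]
  have gM : ∀ i, g i M = C i 1 - m := fun i => by rw [g1 i M le_rfl, hu1]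
  have hcyc : ∀ i, g i (M + 2) = g (i + 1) 0 := fun i => by
    rw [g3, g1 _ _ (Nat.zero_le _), hu0]
  have hdist : ∀ {a : E3}, dist a m < 1 / 2 → (∀ i s, 1 ≤ dist (C i s) a) → ∀ i, ∀ r < M + 2,
      ∀ x ∈ segment ℝ (g i r) (g i (r + 1)), 1 - ε ≤ dist x (a - m) := by
    intro a ham hda i r hr x hx
    have hda' : ∀ i s, 1 ≤ dist (C i s - m) (a - m) := fun i s => by
      rw [dist_sub_right]; exact hda i s
    have hgap' : dist (C i 1 - m) (C (i + 1) 0 - m) ≤ 1 / 2 := by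
      rw [dist_sub_right]; exact hgap i
    rw [dist_eq_norm] at ham
    rcases lt_trichotomy r M with h | rfl | h
    · have hb : segment ℝ (g i r) (g i (r + 1)) ⊆ Metric.ball (g i r) ε := by
        refine (convex_ball _ _).segment_subset (Metric.mem_ball_self hε) ?_
        rw [g1 i r h.le, g1 i (r + 1) h, Metric.mem_ball', dist_sub_right]
        exact hunif i _ _ (hud r)
      have h1 := Metric.mem_ball'.1 (hb hx)
      have h2 := hda' i (u r)
      rw [← g1 i r h.le] at h2
      linarith [dist_triangle (g i r) x (a - m)]
    · rw [gM, g2] at hx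
      linarith [one_le_dist_of_mem_segment_tentPoint ham (hda' i 1) (hda' (i + 1) 0) hgap' hx]
    · obtain rfl : r = M + 1 := by omega
      rw [g2, g3, segment_symm, tentPoint_comm] at hx
      rw [dist_comm] at hgap'
      linarith [one_le_dist_of_mem_segment_tentPoint ham (hda' (i + 1) 0) (hda' i 1) hgap' hx]
  have hcone : ∀ {a x : E3} {y : ℝ} {i : Fin k} {s : I}, y ∈ Icc (0 : ℝ) 1 → a - m = y • (x - m) →
      (∃ n ≤ M, u n = s) → (x = C i s ∨ x ∈ segment ℝ (C i 1) (C (i + 1) 0)) →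
      ∃ n, ∃ x ∈ segment ℝ (blockSeq (M + 2) g n) (blockSeq (M + 2) g (n + 1)),
        ∃ y ∈ Icc (0 : ℝ) 1, a - m = y • x := by
    rintro a x y i s hy e ⟨r, hr, rfl⟩ (rfl | hx)
    · obtain ⟨n, hn, -⟩ := exists_blockSeq_edge_eq hcyc i (r := r) (by omega)
      refine ⟨n, _, left_mem_segment ℝ _ _, y, hy, ?_⟩
      rw [hn, g1 i r hr, e]
    · have hx' : x - m ∈ segment ℝ (C i 1 - m) (C (i + 1) 0 - m) := by
        simpa only [sub_eq_neg_add] using (mem_segment_translate ℝ (-m)).2 hx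
      obtain ⟨x', hx', y', hy', e'⟩ := exists_mem_tent hx'
      have hyy : y * y' ∈ Icc (0 : ℝ) 1 :=
        ⟨mul_nonneg hy.1 hy'.1, mul_le_one₀ hy.2 hy'.1 hy'.2⟩
      rcases hx' with h | h
      · obtain ⟨n, hn, hn'⟩ := exists_blockSeq_edge_eq hcyc i (r := M) (by omega)
        exact ⟨n, x', by rwa [hn, hn', gM, g2], _, hyy, by rw [e, e', smul_smul]⟩
      · obtain ⟨n, hn, hn'⟩ := exists_blockSeq_edge_eq hcyc i (r := M + 1) (by omega)
        exact ⟨n, x', by rwa [hn, hn', g2, g3], _, hyy, by rw [e, e', smul_smul]⟩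
  have hconv : (0 : E3) ∈ convexHull ℝ (range (blockSeq (M + 2) g)) := by
    have hc : Convex ℝ ((fun z => -m + z) ⁻¹' convexHull ℝ (range (blockSeq (M + 2) g))) :=
      (convex_convexHull ℝ _).translate_preimage_right _
    have := convexHull_min ?_ hc hF
    · simpa using this
    · rintro _ ⟨i, s, hs, rfl⟩
      obtain ⟨r, hr, rfl⟩ := huF s (Finset.mem_insert_of_mem (Finset.mem_insert_of_mem hs))
      obtain ⟨n, hn, -⟩ := exists_blockSeq_edge_eq hcyc i (r := r) (by omega)
      refine subset_convexHull ℝ _ ⟨n, ?_⟩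
      rw [hn, g1 i r hr, sub_eq_neg_add]
  have main := le_length_of_closed_polygon (v := blockSeq (M + 2) g) (N := k * (M + 2))
    (a := a - m) (b := b - m) (ρ := 1 - ε) (Nat.mul_pos (NeZero.pos k) (by omega))
    (blockSeq_add_period (by omega)) (by linarith) ?_ hconv
    (hcone hya ea (huF sa (by simp)) hxa) (hcone hyb eb (huF sb (by simp)) hxb)
  · rw [dist_sub_right, sum_blockSeq_edge hcyc] at main
    refine main.trans ?_
    rw [← Finset.sum_add_distrib]
    refine Finset.sum_le_sum fun i _ => ?_
    rw [Finset.sum_range_succ, Finset.sum_range_succ, gM, g2, g3, add_assoc]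
    refine add_le_add ?_ ?_
    · refine le_trans (le_of_eq (Finset.sum_congr rfl fun r hr => ?_))
        (sum_dist_le_curveLength (hfin i) hu M)
      have hr := Finset.mem_range.1 hr
      rw [g1 i r hr.le, g1 i (r + 1) hr, dist_sub_right]
    · refine (dist_tentPoint_add_le _ _).trans ?_
      rw [dist_sub_right]
      exact add_cube_le_phi dist_nonneg (hgap i)
  · intro n x hx
    obtain ⟨i, r, hr, e1, e2⟩ := exists_blockSeq_edge (by omega) hcyc n
    rw [e1, e2] at hx
    have h1 := hdist ham hda i r hr x hx
    refine ⟨?_, h1, hdist hbm hdb i r hr x hx⟩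
    -- The apex is off the polygon: it is closer than 1/2 to a, while the polygon has distance at
    -- least 1 - ε > 1/2.
    rintro rfl
    rw [dist_zero_left, ← dist_eq_norm] at h1
    linarith

theorem exists_diam_sub_le_dist {X : Type*} [PseudoMetricSpace X] {A : Set X} (hA : A.Nonempty)
    {ε : ℝ} (hε : 0 < ε) : ∃ a ∈ A, ∃ b ∈ A, Metric.diam A - ε ≤ dist a b := by
  by_contra! h
  obtain ⟨a, ha⟩ := hA
  have := Metric.diam_le_of_forall_dist_le (C := Metric.diam A - ε)
    (dist_nonneg.trans (h a ha a ha).le) fun x hx y hy => (h x hx y hy).le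
  linarith

theorem isCompact_range_cone {a : E3} (c : Path a a) (p : E3) : IsCompact (range (cone c p)) :=
  isCompact_range (by unfold cone; fun_prop)

end

/-! ### Passage to the limit -/

theorem mainTheorem9 {k : ℕ} [NeZero k] (C : Fin k → C(unitInterval, E3))
    (hgap : ∀ i : Fin k, dist (C i 1) (C (i + 1) 0) ≤ 1 / 2)
    (m : E3) (hm : m ∈ convexHull ℝ (Set.range (interpolatedClosedCurve C)))
    (A : Set E3) (hA : A.Nonempty)
    (hAK : A ⊆ Set.range (cone (interpolatedClosedCurve C) m))
    (hdist : ∀ i : Fin k, ∀ x ∈ A, 1 ≤ Metric.infDist x (Set.range (C i)))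
    (hAm : sSup ((fun x => dist x m) '' A) < 1 / 2)
    (hdiam : Metric.diam A < 1 / 2) :
    ((2 * Real.pi + 2 * Metric.diam A
        - ∑ i : Fin k, phi (dist (C i 1) (C (i + 1) 0)) : ℝ) : EReal)
      ≤ ((∑ i : Fin k, curveLength (C i) : ENNReal) : EReal) := by
  by_cases hfin : ∀ i, curveLength (C i) ≠ ⊤
  -- The real `sSup` of an unbounded set is 0, so `hAm` bounds the single points only because the
  -- cone is compact.
  · have hbdd : BddAbove ((fun x => dist x m) '' A) :=
      ((isCompact_range_cone _ m).image (by fun_prop : Continuous fun x : E3 => dist x m)).bddAbove.mono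
        (Set.image_mono hAK)
    have hm' : ∀ a ∈ A, dist a m < 1 / 2 := fun a ha =>
      (le_csSup hbdd (Set.mem_image_of_mem _ ha)).trans_lt hAm
    have hd : ∀ a ∈ A, ∀ i s, 1 ≤ dist (C i s) a := fun a ha i s => by
      rw [dist_comm]
      exact (hdist i a ha).trans (Metric.infDist_le_dist_of_mem (Set.mem_range_self s))
    have key : ∀ ε : ℝ, 0 < ε → ε < 1 / 2 → 2 * Real.pi * (1 - ε) + 2 * (Metric.diam A - ε)
        ≤ ∑ i, (curveLength (C i)).toReal + ∑ i, phi (dist (C i 1) (C (i + 1) 0)) := by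
      intro ε hε hε'
      obtain ⟨a, ha, b, hb, hab⟩ := exists_diam_sub_le_dist hA hε
      have := le_sum_curveLength_add C hgap hm (hAK ha) (hAK hb) (hd a ha) (hd b hb) (hm' a ha)
        (hm' b hb) hfin hε hε'
      linarith
    have hreal : 2 * Real.pi + 2 * Metric.diam A - ∑ i, phi (dist (C i 1) (C (i + 1) 0))
        ≤ ∑ i, (curveLength (C i)).toReal := by
      by_contra! hlt
      have hπ := Real.pi_pos
      -- The estimate `key` loses ε(2π + 2); η makes this half of the supposed deficit.
      obtain ⟨η, hη, h1⟩ : ∃ η > 0, ∑ i, (curveLength (C i)).toReal + η * (2 * Real.pi + 2)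
          < 2 * Real.pi + 2 * Metric.diam A - ∑ i, phi (dist (C i 1) (C (i + 1) 0)) := by
        refine ⟨(2 * Real.pi + 2 * Metric.diam A - ∑ i, phi (dist (C i 1) (C (i + 1) 0))
          - ∑ i, (curveLength (C i)).toReal) / 2 / (2 * Real.pi + 2), ?_, ?_⟩
        · exact div_pos (by linarith) (by linarith)
        · rw [div_mul_cancel₀ _ (by linarith)]; linarith
      have h2 := key (min η (1 / 4)) (lt_min hη (by norm_num))
        ((min_le_right _ _).trans_lt (by norm_num))
      have h3 := mul_le_mul_of_nonneg_right (min_le_left η (1 / 4))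
        (show 0 ≤ 2 * Real.pi + 2 by linarith)
      linarith
    rw [← ENNReal.ofReal_toReal (ENNReal.sum_ne_top.2 fun i _ => hfin i),
      ENNReal.toReal_sum fun i _ => hfin i, EReal.coe_ennreal_ofReal,
      max_eq_left (Finset.sum_nonneg fun _ _ => ENNReal.toReal_nonneg)]
    exact EReal.coe_le_coe_iff.2 hreal
  · push Not at hfin
    obtain ⟨i, hi⟩ := hfin
    have : ∑ i, curveLength (C i) = ⊤ := ENNReal.sum_eq_top.2 ⟨i, Finset.mem_univ i, hi⟩
    rw [this, EReal.coe_ennreal_top]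
    exact le_top
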